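/- For $\epsilon>0$, $\rho\in(0,1)$ and an integer $k\ge 1$ put $$\beta=\beta(\epsilon,\rho,k)=\left(5+\tfrac{16}{\epsilon}\right)^{\log_2\rho+2/\rho}\cdot k^{\log_2(5+16/\epsilon)} .$$ In the multi-pass streaming model the edges of an undirected unweighted graph $G$ on the vertex set $\{1,\dots,n\}$ are presented to a randomized algorithm one by one, without repetitions and in arbitrary order, in each of several passes. The space of a run is the largest number of memory words, of $O(\log n)$ bits each, that are in use at any time; local computation is free. The algorithm computes an $(\alpha,b)$-approximation for all-pairs shortest paths (APSP) if it halts with probability one and then, whatever its random choices were, its final memory determines for every connected pair $u,v$ a walk of $G$ from $u$ to $v$ of length at most $\alpha\cdot\mathrm{dist}_G(u,v)+b$, and tells which pairs are not connected. A bound $O(f)$ holds with high probability if for every $c>0$ there is a constant $C$ such that $C\cdot f$ is a bound with probability at least $1-n^{-c}$; the algorithm may depend on $c$. There is an absolute constant $C_0$ such that for all integers $n,k\ge 1$, all $\epsilon>0$ and all $\rho\in(0,1)$ the following holds for all graphs $G$ on $n$ vertices and all orders of their edges. (1) There is a multi-pass streaming algorithm that computes a $(4+\epsilon,\,C_0\beta)$-approximation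 for APSP, uses $O(n^{1+\rho}\log n)$ space with high probability, and always makes at most $C_0\beta$ passes. (2) There is a multi-pass streaming algorithm that computes a $(4+\epsilon,\,C_0\beta)$-approximation for APSP, whose expected space is at most $C_0\left(n^{1+1/k}+(\beta+\log n)\,n\right)$, and which makes $O\!\left(\frac{n^{\rho}}{\rho}\cdot\log n\cdot\beta\right)$ passes with high probability. The algorithms depend on $n,k,\epsilon,\rho$ and $c$ only, not on $G$ or the order of its edges; the constants hidden in the two $O(\cdot)$ depend on $c$ only. -/

import Mathlib

open scoped ENNReal

noncomputable section

namespace Streaming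

/-- A memory word for inputs on `n` vertices: a number in `{0, …, n}`, that is `O(log n)` bits,
enough for a vertex identifier or a hop distance. -/
abbrev Word (n : ℕ) : Type := Fin (n + 1)

/-- The contents of the working memory. Its length is the space in use, in words. -/
abbrev Memory (n : ℕ) : Type := List (Word n)

/-- A randomized multi-pass streaming algorithm for graphs on the vertex set `Fin n`.
Everything it remembers, its control state and the random choices it wants to reuse included, has
to be kept in memory: each transition sees only the current memory and, within a pass, the current
edge. As usual in the streaming model, the algorithm is charged for memory and for passes, not for
local computation. -/
structure Algorithm (n : ℕ) where
  /-- the (random) memory before the first pass -/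
  init : PMF (Memory n)
  /-- asked before each pass: stop now? -/
  halt : Memory n → Bool
  /-- the (random) new memory when an edge of the stream is read -/
  step : Memory n → Sym2 (Fin n) → PMF (Memory n)
  /-- the (random) new memory when the end of the stream is reached -/
  endPass : Memory n → PMF (Memory n)
  /-- the answer that is read off the final memory: for each ordered pair of vertices a walk,
  given as the list of its vertices, or `none` for "not connected" -/
  output : Memory n → Fin n → Fin n → Option (List (Fin n))

/-- A snapshot of a run: the memory, the largest memory so far, the number of passes so far. -/
structure Config (n : ℕ) where
  mem : Memory n
  peak : ℕ
  passes : ℕ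

/-- Replace the memory, and update the peak. -/
def Config.write {n : ℕ} (c : Config n) (m : Memory n) : Config n :=
  ⟨m, max c.peak m.length, c.passes⟩

/-- Count one more pass. -/
def Config.countPass {n : ℕ} (c : Config n) : Config n :=
  ⟨c.mem, c.peak, c.passes + 1⟩

namespace Algorithm

variable {n : ℕ} (A : Algorithm n)

/-- Read a list of edges, one after the other. -/
def read : List (Sym2 (Fin n)) → Config n → PMF (Config n)
  | [], c => PMF.pure c
  | e :: es, c => ((A.step c.mem e).map c.write).bind (read es)

/-- One pass over the stream `s`, unless the algorithm has halted. -/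
def pass (s : List (Sym2 (Fin n))) (c : Config n) : PMF (Config n) :=
  if A.halt c.mem then PMF.pure c
  else (A.read s c.countPass).bind fun d => (A.endPass d.mem).map d.write

/-- The law of the snapshot after at most `t` passes over the stream `s`. -/
def run (s : List (Sym2 (Fin n))) : ℕ → PMF (Config n)
  | 0 => A.init.map fun m => ⟨m, m.length, 0⟩
  | t + 1 => (run s t).bind (A.pass s)

/-- On the stream `s` the algorithm halts with probability one. -/
def Terminates (s : List (Sym2 (Fin n))) : Prop :=
  ⨆ t, (A.run s t).toOuterMeasure {c | A.halt c.mem = true} = 1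

/-- On the stream `s` the quantity `f`, which can only grow during a run (the peak memory, or the
number of passes), never exceeds `x`. -/
def SurelyLE (s : List (Sym2 (Fin n))) (f : Config n → ℕ) (x : ℝ) : Prop :=
  ∀ t, ∀ c ∈ (A.run s t).support, (f c : ℝ) ≤ x

/-- On the stream `s` the final value of `f` is at most `x` with probability at least `p`. -/
def ProbLE (s : List (Sym2 (Fin n))) (f : Config n → ℕ) (x p : ℝ) : Prop :=
  ∀ t, ENNReal.ofReal p ≤ (A.run s t).toOuterMeasure {c | (f c : ℝ) ≤ x}

/-- On the stream `s` the expectation of the final value of `f` is at most `x`. -/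
def ExpectedLE (s : List (Sym2 (Fin n))) (f : Config n → ℕ) (x : ℝ) : Prop :=
  ∀ t, ∑' c, A.run s t c * (f c : ℝ≥0∞) ≤ ENNReal.ofReal x

end Algorithm

/-- `s` lists the edges of `G`, without repetitions, in some order. -/
def IsEdgeStream {n : ℕ} (G : SimpleGraph (Fin n)) (s : List (Sym2 (Fin n))) : Prop :=
  s.Nodup ∧ ∀ e, e ∈ s ↔ e ∈ G.edgeSet

/-- `out` solves all-pairs shortest paths in `G` up to an `(α, β)` approximation: for connected
pairs it names a walk of `G` of length at most `α · dist + β` (so that this length is an estimate of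
the distance which is never too small), and it recognizes the pairs that are not connected. -/
def IsApproxAPSP {n : ℕ} (G : SimpleGraph (Fin n)) (α β : ℝ)
    (out : Fin n → Fin n → Option (List (Fin n))) : Prop :=
  ∀ u v,
    (G.Reachable u v →
      ∃ p : G.Walk u v, out u v = some p.support ∧ (p.length : ℝ) ≤ α * (G.dist u v : ℝ) + β) ∧
    (¬ G.Reachable u v → out u v = none)

/-- On the stream `s` of the graph `G` the algorithm halts with probability one, and whenever it
halts its answer is an `(α, β)` approximation for all-pairs shortest paths. -/
def Algorithm.ComputesAPSP {n : ℕ} (A : Algorithm n) (G : SimpleGraph (Fin n))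
    (s : List (Sym2 (Fin n))) (α β : ℝ) : Prop :=
  A.Terminates s ∧
    ∀ t, ∀ c ∈ (A.run s t).support, A.halt c.mem = true → IsApproxAPSP G α β (A.output c.mem)

/-- `(5 + 16/ε) ^ (log ρ + 2/ρ) · k ^ (log (5 + 16/ε))`, with logarithms to base two. -/
def beta (ε ρ : ℝ) (k : ℕ) : ℝ :=
  (5 + 16 / ε) ^ (Real.logb 2 ρ + 2 / ρ) * (k : ℝ) ^ Real.logb 2 (5 + 16 / ε)

end Streaming

end

/-! Both algorithms are deterministic: every run has a Dirac law, so the expected and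
high-probability bounds are weakenings of bounds that hold surely, and one constant serves every
`c`.

The stored subgraph `K` is a spanner built from nested sets of centers `A 0 = V ⊇ A 1 ⊇ … ⊇ A ℓ = ∅`
with radii `r i`, jump lengths `L i` and depths `R i = 2 * (L i + r i)`. Level `i` stores a BFS
forest from `A i` to depth `R i`, together with walks from each center to the close centers
(distance at most `R i`) that it learns. Centers that learn fewer than `t i` learn all of them.
Among the others, a maximal family whose known sets are pairwise disjoint becomes `A (i + 1)`.
Disjointness gives `|A (i + 1)| * t i ≤ |A i|`, and `A ℓ` is empty because the product of the
thresholds exceeds `n`. Maximality puts a next center within `2 * R i` of every popular center.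

For the stretch (`exists_walk_of_hierarchy`), choose for the start `u` a level `i` at which `u` is
within `r i` of `A i` but not within `r (i + 1)` of `A (i + 1)`. The center near `u` is then not
popular, and every vertex at distance `L i` is reached in `K` through two centers by a walk of
length `3 * L i + 4 * r i ≤ (4 + ε) * L i`. Such jumps are repeated along the walk; the last one
costs the additive term `r ℓ`.

Close centers are found by parallel BFS, one pass per step, where each vertex remembers at most `r`
sources. A table is complete unless it is full, and every stored edge is paid for by a new table
entry. For (1) the cap equals the threshold, about `n ^ ρ`, and one detection from all centers
suffices. For (2), if `k * ρ > 2`, the cap is `1` and detection is repeated from each member of a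
family that isolates every element of every small set (`exists_selective`, polynomials over a finite
field). Exponents double from `1 / k` up to `ρ / 2`: this keeps the stored walks geometrically
decreasing and the family of size `O(n ^ ρ / ρ ^ 2)`, while the number of levels is just the
exponent of `beta` plus one. If `k * ρ ≤ 2`, the first construction with exponent `1 / k` does it.

If `n ≤ beta`, a spanning forest answers everything. Otherwise `5 ^ (1 / ρ) ≤ beta < n` gives `1 / ρ
≤ log n`, which turns the number of levels in (1) and a factor `1 / ρ` in (2) into the logarithm of
the claim. -/

noncomputable section

namespace Streaming

section

/-! ### Deterministic multi-pass programs -/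

/-- Lists of vertices, written one after the other with the word `n` as end marker. -/
def encodeLists {n : ℕ} (L : List (List (Fin n))) : Memory n :=
  L.flatMap fun l => l.map Fin.castSucc ++ [Fin.last n]

/-- The end marker is not the cast of any vertex, so its first occurrence delimits the first list
and the code can be parsed uniquely. -/
theorem map_castSucc_append_last_inj {n : ℕ} :
    ∀ (l l' : List (Fin n)) (m m' : Memory n),
      l.map Fin.castSucc ++ Fin.last n :: m = l'.map Fin.castSucc ++ Fin.last n :: m' →
        l = l' ∧ m = m'
  | [], [], m, m', h => by simpa using h
  | [], b :: l', m, m', h => by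
      simp only [List.map_nil, List.nil_append, List.map_cons, List.cons_append,
        List.cons.injEq] at h
      exact absurd h.1.symm (Fin.castSucc_lt_last b).ne
  | a :: l, [], m, m', h => by
      simp only [List.map_nil, List.nil_append, List.map_cons, List.cons_append,
        List.cons.injEq] at h
      exact absurd h.1 (Fin.castSucc_lt_last a).ne
  | a :: l, b :: l', m, m', h => by
      simp only [List.map_cons, List.cons_append, List.cons.injEq, Fin.castSucc_inj] at h
      obtain ⟨h1, h2⟩ := map_castSucc_append_last_inj l l' m m' h.2
      exact ⟨by rw [h.1, h1], h2⟩

theorem encodeLists_injective {n : ℕ} : Function.Injective (encodeLists (n := n)) := by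
  intro L
  induction L with
  | nil =>
    intro L' h
    cases L' with
    | nil => rfl
    | cons l L' => simp [encodeLists] at h
  | cons l L ih =>
    intro L' h
    cases L' with
    | nil => simp [encodeLists] at h
    | cons l' L' =>
      simp only [encodeLists, List.flatMap_cons, List.append_assoc, List.singleton_append] at h
      obtain ⟨h1, h2⟩ := map_castSucc_append_last_inj _ _ _ _ h
      rw [h1, ih h2]

/-- The number of words that `encodeLists` uses. -/
def listsCost {n : ℕ} (L : List (List (Fin n))) : ℕ := (L.map fun l => l.length + 1).sum

theorem length_encodeLists {n : ℕ} (L : List (List (Fin n))) :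
    (encodeLists L).length = listsCost L := by
  simp [encodeLists, listsCost, List.length_flatMap]

/-- A pass of a deterministic program with states in `σ`. -/
structure Pass (n : ℕ) (σ : Type) where
  step : σ → Sym2 (Fin n) → σ
  fin : σ → σ

variable {n : ℕ} {σ : Type}

/-- The effect of one pass over the stream `s`. -/
def Pass.apply (o : Pass n σ) (s : List (Sym2 (Fin n))) (x : σ) : σ :=
  o.fin (s.foldl o.step x)

/-- The effect of a program, a list of passes, on the stream `s`. -/
def runProgram (s : List (Sym2 (Fin n))) : List (Pass n σ) → σ → σ
  | [], x => x
  | o :: os, x => runProgram s os (o.apply s x)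

/-- All states that occur while the program reads the stream `s` have at most the given cost. -/
def BoundedBy (cost : σ → ℕ) (M : ℕ) (s : List (Sym2 (Fin n))) : List (Pass n σ) → σ → Prop
  | [], x => cost x ≤ M
  | o :: os, x => (∀ l, l <+: s → cost (l.foldl o.step x) ≤ M) ∧
      BoundedBy cost M s os (o.apply s x)

theorem runProgram_append (s : List (Sym2 (Fin n))) (p q : List (Pass n σ)) (x : σ) :
    runProgram s (p ++ q) x = runProgram s q (runProgram s p x) := by
  induction p generalizing x with
  | nil => rfl
  | cons o p ih => exact ih _

theorem BoundedBy.append {cost : σ → ℕ} {M : ℕ} {s : List (Sym2 (Fin n))}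
    {p q : List (Pass n σ)} {x : σ} (hp : BoundedBy cost M s p x)
    (hq : BoundedBy cost M s q (runProgram s p x)) : BoundedBy cost M s (p ++ q) x := by
  induction p generalizing x with
  | nil => exact hq
  | cons o p ih => exact ⟨hp.1, ih hp.2 hq⟩

theorem BoundedBy.cost_le {cost : σ → ℕ} {M : ℕ} {s : List (Sym2 (Fin n))}
    {p : List (Pass n σ)} {x : σ} (hp : BoundedBy cost M s p x) : cost x ≤ M := by
  cases p with
  | nil => exact hp
  | cons o p => exact hp.1 [] (List.nil_prefix)

/-- A pass that ignores the stream and only computes locally. -/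
def localPass (f : σ → σ) : Pass n σ := ⟨fun x _ => x, f⟩

theorem foldl_localPass_step (f : σ → σ) (l : List (Sym2 (Fin n))) (x : σ) :
    l.foldl (localPass f).step x = x := by
  induction l with
  | nil => rfl
  | cons e l ih => exact ih

theorem localPass_apply (f : σ → σ) (s : List (Sym2 (Fin n))) (x : σ) :
    (localPass f).apply s x = f x := by
  rw [Pass.apply, foldl_localPass_step]; rfl

/-- The state after the first `t` passes. -/
def stateAfter (prog : List (Pass n σ)) (x₀ : σ) (s : List (Sym2 (Fin n))) (t : ℕ) : σ :=
  runProgram s (prog.take t) x₀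

theorem stateAfter_succ (prog : List (Pass n σ)) (x₀ : σ) (s : List (Sym2 (Fin n))) (t : ℕ)
    (ht : t < prog.length) :
    stateAfter prog x₀ s (t + 1) = prog[t].apply s (stateAfter prog x₀ s t) := by
  rw [stateAfter, List.take_add_one, List.getElem?_eq_getElem ht, runProgram_append]
  rfl

theorem BoundedBy.drop {cost : σ → ℕ} {M : ℕ} {s : List (Sym2 (Fin n))}
    {p q : List (Pass n σ)} {x : σ} (h : BoundedBy cost M s (p ++ q) x) :
    BoundedBy cost M s q (runProgram s p x) := by
  induction p generalizing x with
  | nil => exact h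
  | cons o p ih => exact ih h.2

theorem BoundedBy.intermediate {cost : σ → ℕ} {M : ℕ} {s : List (Sym2 (Fin n))}
    {prog : List (Pass n σ)} {x₀ : σ} (h : BoundedBy cost M s prog x₀) {t : ℕ}
    (ht : t < prog.length) {l : List (Sym2 (Fin n))} (hl : l <+: s) :
    cost (l.foldl prog[t].step (stateAfter prog x₀ s t)) ≤ M := by
  have h1 : BoundedBy cost M s (prog.take t ++ prog.drop t) x₀ := by
    rwa [List.take_append_drop]
  have h2 := h1.drop
  rw [List.drop_eq_getElem_cons ht] at h2
  exact h2.1 l hl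

theorem BoundedBy.after {cost : σ → ℕ} {M : ℕ} {s : List (Sym2 (Fin n))}
    {prog : List (Pass n σ)} {x₀ : σ} (h : BoundedBy cost M s prog x₀) (t : ℕ) :
    cost (stateAfter prog x₀ s t) ≤ M := by
  have h1 : BoundedBy cost M s (prog.take t ++ prog.drop t) x₀ := by
    rwa [List.take_append_drop]
  exact h1.drop.cost_le

/-- The memory contents for a state of a program at a given position. -/
def memoryOf (code : σ → List (List (Fin n))) (ctr : ℕ → List (Fin n)) (z : σ × ℕ) : Memory n :=
  encodeLists (ctr z.2 :: code z.1)

/-- `programAlgorithm` decodes with `Function.invFun`, which inverts the encoding only thanks to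
this. -/
theorem memoryOf_injective {code : σ → List (List (Fin n))} {ctr : ℕ → List (Fin n)}
    (hcode : Function.Injective code) (hctr : Function.Injective ctr) :
    Function.Injective (memoryOf code ctr) := by
  intro z z' h
  have := encodeLists_injective h
  rw [List.cons.injEq] at this
  exact Prod.ext (hcode this.2) (hctr this.1)

open Classical in
/-- The streaming algorithm that executes a program. -/
def programAlgorithm (prog : List (Pass n σ)) (x₀ : σ)
    (out : σ → Fin n → Fin n → Option (List (Fin n)))
    (code : σ → List (List (Fin n))) (ctr : ℕ → List (Fin n)) : Algorithm n :=
  have : Nonempty (σ × ℕ) := ⟨(x₀, 0)⟩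
  let decode := Function.invFun (memoryOf code ctr)
  { init := PMF.pure (memoryOf code ctr (x₀, 0))
    halt := fun m => decide (prog.length ≤ (decode m).2)
    step := fun m e => PMF.pure <| match prog[(decode m).2]? with
      | some o => memoryOf code ctr (o.step (decode m).1 e, (decode m).2)
      | none => m
    endPass := fun m => PMF.pure <| match prog[(decode m).2]? with
      | some o => memoryOf code ctr (o.fin (decode m).1, (decode m).2 + 1)
      | none => m
    output := fun m => out (decode m).1 }

section

variable {prog : List (Pass n σ)} {x₀ : σ} {out : σ → Fin n → Fin n → Option (List (Fin n))}
  {code : σ → List (List (Fin n))} {ctr : ℕ → List (Fin n)}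

theorem programAlgorithm_halt (hm : Function.Injective (memoryOf code ctr)) (z : σ × ℕ) :
    (programAlgorithm prog x₀ out code ctr).halt (memoryOf code ctr z) = true ↔
      prog.length ≤ z.2 := by
  have : Nonempty (σ × ℕ) := ⟨z⟩
  simp [programAlgorithm, Function.leftInverse_invFun hm z]

theorem programAlgorithm_output (hm : Function.Injective (memoryOf code ctr)) (z : σ × ℕ) :
    (programAlgorithm prog x₀ out code ctr).output (memoryOf code ctr z) = out z.1 := by
  have : Nonempty (σ × ℕ) := ⟨z⟩
  simp [programAlgorithm, Function.leftInverse_invFun hm z]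

theorem programAlgorithm_step (hm : Function.Injective (memoryOf code ctr)) (x : σ) {t : ℕ}
    (ht : t < prog.length) (e : Sym2 (Fin n)) :
    (programAlgorithm prog x₀ out code ctr).step (memoryOf code ctr (x, t)) e =
      PMF.pure (memoryOf code ctr (prog[t].step x e, t)) := by
  have : Nonempty (σ × ℕ) := ⟨(x, 0)⟩
  simp [programAlgorithm, Function.leftInverse_invFun hm (x, t), ht]

theorem programAlgorithm_endPass (hm : Function.Injective (memoryOf code ctr)) (x : σ) {t : ℕ}
    (ht : t < prog.length) :
    (programAlgorithm prog x₀ out code ctr).endPass (memoryOf code ctr (x, t)) =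
      PMF.pure (memoryOf code ctr (prog[t].fin x, t + 1)) := by
  have : Nonempty (σ × ℕ) := ⟨(x, 0)⟩
  simp [programAlgorithm, Function.leftInverse_invFun hm (x, t), ht]

/-- Only an upper bound for the peak is carried along. All prefixes of the stream are needed because
the memory counts after every edge. -/
theorem programAlgorithm_read (hm : Function.Injective (memoryOf code ctr)) {t K : ℕ}
    (ht : t < prog.length) (l : List (Sym2 (Fin n))) (x : σ) (pk q : ℕ) (hpk : pk ≤ K)
    (hK : ∀ l', l' <+: l → (memoryOf code ctr (l'.foldl prog[t].step x, t)).length ≤ K) :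
    ∃ pk' ≤ K, (programAlgorithm prog x₀ out code ctr).read l ⟨memoryOf code ctr (x, t), pk, q⟩ =
      PMF.pure ⟨memoryOf code ctr (l.foldl prog[t].step x, t), pk', q⟩ := by
  induction l generalizing x pk with
  | nil => exact ⟨pk, hpk, rfl⟩
  | cons e l ih =>
    have h1 := hK [e] (by simp)
    obtain ⟨pk', hpk', h⟩ := ih (prog[t].step x e)
      (max pk (memoryOf code ctr (prog[t].step x e, t)).length) (max_le hpk h1)
      fun l' hl' => hK (e :: l') (by simpa using hl')
    refine ⟨pk', hpk', ?_⟩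
    rw [Algorithm.read, programAlgorithm_step hm x ht, PMF.pure_map, PMF.pure_bind]
    exact h

/-- The `min` expresses that the snapshot is frozen once the program counter reaches the end. The
space `M + j + 1` is that of the state, the counter and the marker after the counter. -/
theorem programAlgorithm_run (hm : Function.Injective (memoryOf code ctr))
    {s : List (Sym2 (Fin n))} {M j : ℕ}
    (hM : BoundedBy (fun x => listsCost (code x)) M s prog x₀)
    (hj : ∀ t ≤ prog.length, (ctr t).length ≤ j) (t : ℕ) :
    ∃ pk ≤ M + j + 1, (programAlgorithm prog x₀ out code ctr).run s t =
      PMF.pure ⟨memoryOf code ctr (stateAfter prog x₀ s (min t prog.length), min t prog.length),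
        pk, min t prog.length⟩ := by
  have hlen : ∀ x t, listsCost (code x) ≤ M → t ≤ prog.length →
      (memoryOf code ctr (x, t)).length ≤ M + j + 1 := by
    intro x t hx ht
    have h1 : (memoryOf code ctr (x, t)).length = (ctr t).length + 1 + listsCost (code x) := by
      rw [memoryOf, length_encodeLists]
      simp [listsCost]
    have := hj t ht
    omega
  induction t with
  | zero =>
    refine ⟨_, hlen x₀ 0 hM.cost_le (Nat.zero_le _), ?_⟩
    simp only [Algorithm.run, Nat.zero_min]
    exact PMF.pure_map _ _
  | succ t ih =>
    obtain ⟨pk, hpk, h⟩ := ih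
    rw [Algorithm.run, h, PMF.pure_bind]
    by_cases ht : t < prog.length
    · have e1 : min t prog.length = t := min_eq_left ht.le
      have e2 : min (t + 1) prog.length = t + 1 := min_eq_left ht
      rw [e1, e2, Algorithm.pass, if_neg]
      · obtain ⟨pk', hpk', h'⟩ := programAlgorithm_read (x₀ := x₀) (out := out) hm ht s
          (stateAfter prog x₀ s t) pk (t + 1) hpk
          fun l' hl' => hlen _ _ (hM.intermediate ht hl') ht.le
        simp only [Config.countPass]
        rw [h', PMF.pure_bind, programAlgorithm_endPass hm _ ht, PMF.pure_map]
        refine ⟨_, ?_, by rw [stateAfter_succ _ _ _ _ ht]; rfl⟩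
        refine max_le hpk' (hlen _ _ ?_ ht)
        have := hM.after (t + 1)
        rwa [stateAfter_succ _ _ _ _ ht] at this
      · simp only [programAlgorithm_halt hm]
        omega
    · have e1 : min t prog.length = prog.length := min_eq_right (not_lt.1 ht)
      have e2 : min (t + 1) prog.length = prog.length := min_eq_right (by omega)
      rw [e1, e2, Algorithm.pass, if_pos]
      · exact ⟨pk, hpk, rfl⟩
      · simp only [programAlgorithm_halt hm, le_refl]

theorem programAlgorithm_computes (hm : Function.Injective (memoryOf code ctr))
    {s : List (Sym2 (Fin n))} {M j : ℕ}
    (hM : BoundedBy (fun x => listsCost (code x)) M s prog x₀)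
    (hj : ∀ t ≤ prog.length, (ctr t).length ≤ j) {G : SimpleGraph (Fin n)} {α β : ℝ}
    (hout : IsApproxAPSP G α β (out (runProgram s prog x₀))) :
    (programAlgorithm prog x₀ out code ctr).ComputesAPSP G s α β ∧
    (programAlgorithm prog x₀ out code ctr).SurelyLE s Config.peak ((M + j + 1 : ℕ) : ℝ) ∧
    (programAlgorithm prog x₀ out code ctr).SurelyLE s Config.passes (prog.length : ℝ) := by
  have hrun := programAlgorithm_run (out := out) hm hM hj
  refine ⟨⟨le_antisymm (iSup_le fun t => ?_) ?_, fun t c hc hh => ?_⟩, fun t c hc => ?_,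
    fun t c hc => ?_⟩
  · obtain ⟨pk, -, h⟩ := hrun t
    rw [h, PMF.toOuterMeasure_pure_apply]
    split_ifs <;> simp
  · refine le_iSup_of_le prog.length ?_
    obtain ⟨pk, -, h⟩ := hrun prog.length
    rw [h, PMF.toOuterMeasure_pure_apply, if_pos]
    simp only [Set.mem_ofPred_eq, programAlgorithm_halt hm, min_self, le_refl]
  · obtain ⟨pk, -, h⟩ := hrun t
    rw [h, PMF.support_pure, Set.mem_singleton_iff] at hc
    subst hc
    rw [programAlgorithm_halt hm] at hh
    have ht : min t prog.length = prog.length := le_antisymm (min_le_right _ _) hh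
    simp only [programAlgorithm_output hm, ht, stateAfter, List.take_length]
    exact hout
  · obtain ⟨pk, hpk, h⟩ := hrun t
    rw [h, PMF.support_pure, Set.mem_singleton_iff] at hc
    subst hc
    exact_mod_cast hpk
  · obtain ⟨pk, -, h⟩ := hrun t
    rw [h, PMF.support_pure, Set.mem_singleton_iff] at hc
    subst hc
    exact_mod_cast min_le_right t _

end

/-! ### Weakening sure bounds to probability, expectation and larger errors -/

theorem Algorithm.SurelyLE.mono {A : Algorithm n} {s : List (Sym2 (Fin n))} {f : Config n → ℕ}
    {x y : ℝ} (h : A.SurelyLE s f x) (hxy : x ≤ y) : A.SurelyLE s f y :=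
  fun t c hc => (h t c hc).trans hxy

theorem Algorithm.SurelyLE.probLE {A : Algorithm n} {s : List (Sym2 (Fin n))} {f : Config n → ℕ}
    {x p : ℝ} (h : A.SurelyLE s f x) (hp : p ≤ 1) : A.ProbLE s f x p := by
  intro t
  rw [((A.run s t).toOuterMeasure_apply_eq_one_iff {c | (f c : ℝ) ≤ x}).2 fun c hc => h t c hc]
  exact ENNReal.ofReal_le_one.2 hp

theorem Algorithm.SurelyLE.expectedLE {A : Algorithm n} {s : List (Sym2 (Fin n))}
    {f : Config n → ℕ} {x : ℝ} (h : A.SurelyLE s f x) : A.ExpectedLE s f x := by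
  intro t
  calc ∑' c, A.run s t c * (f c : ℝ≥0∞) ≤ ∑' c, A.run s t c * ENNReal.ofReal x := by
        refine ENNReal.tsum_le_tsum fun c => ?_
        by_cases hc : A.run s t c = 0
        · simp [hc]
        · gcongr
          rw [← ENNReal.ofReal_natCast]
          exact ENNReal.ofReal_le_ofReal (h t c ((PMF.mem_support_iff _ _).2 hc))
    _ = ENNReal.ofReal x := by rw [ENNReal.tsum_mul_right, PMF.tsum_coe, one_mul]

theorem IsApproxAPSP.mono {G : SimpleGraph (Fin n)} {α β β' : ℝ}
    {out : Fin n → Fin n → Option (List (Fin n))} (h : IsApproxAPSP G α β out) (hβ : β ≤ β') :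
    IsApproxAPSP G α β' out := by
  refine fun u v => ⟨fun huv => ?_, (h u v).2⟩
  obtain ⟨p, hp, hl⟩ := (h u v).1 huv
  exact ⟨p, hp, hl.trans (by gcongr)⟩

theorem Algorithm.ComputesAPSP.mono {A : Algorithm n} {G : SimpleGraph (Fin n)}
    {s : List (Sym2 (Fin n))} {α β β' : ℝ} (h : A.ComputesAPSP G s α β) (hβ : β ≤ β') :
    A.ComputesAPSP G s α β' :=
  ⟨h.1, fun t c hc hh => (h.2 t c hc hh).mono hβ⟩

end

section

/-! ### Walks of bounded length, and the spanner of a hierarchy of centers -/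

section

variable {V : Type*}

/-- There is a walk of length at most `ℓ` from `u` to `v`. -/
def Near (G : SimpleGraph V) (u v : V) (ℓ : ℕ) : Prop := ∃ p : G.Walk u v, p.length ≤ ℓ

namespace Near

variable {G K : SimpleGraph V} {u v w : V} {a b : ℕ}

theorem refl (G : SimpleGraph V) (u : V) (ℓ : ℕ) : Near G u u ℓ := ⟨.nil, Nat.zero_le _⟩

theorem symm : Near G u v a → Near G v u a := fun ⟨p, hp⟩ => ⟨p.reverse, by simpa using hp⟩

theorem trans : Near G u v a → Near G v w b → Near G u w (a + b) :=
  fun ⟨p, hp⟩ ⟨q, hq⟩ => ⟨p.append q, by rw [SimpleGraph.Walk.length_append]; omega⟩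

theorem mono (h : a ≤ b) : Near G u v a → Near G u v b := fun ⟨p, hp⟩ => ⟨p, hp.trans h⟩

theorem map_le (h : G ≤ K) : Near G u v a → Near K u v a :=
  fun ⟨p, hp⟩ => ⟨p.mapLe h, by simpa using hp⟩

theorem of_adj (h : G.Adj u v) : Near G u v 1 := ⟨h.toWalk, by simp⟩

theorem exists_adj (h : Near G u v (a + 1)) : u = v ∨ ∃ x, G.Adj u x ∧ Near G x v a := by
  obtain ⟨p, hp⟩ := h
  cases p with
  | nil => exact .inl rfl
  | cons h q => exact .inr ⟨_, h, q, by simpa using hp⟩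

theorem zero (h : Near G u v 0) : u = v := by
  obtain ⟨p, hp⟩ := h
  exact SimpleGraph.Walk.eq_of_length_eq_zero (Nat.le_zero.1 hp)

end Near

/-- The graph whose edges are the given pairs. -/
def pairGraph (E : Finset (V × V)) : SimpleGraph V := .fromRel fun a b => (a, b) ∈ E

theorem pairGraph_le {E : Finset (V × V)} {G : SimpleGraph V} (h : ∀ p ∈ E, G.Adj p.1 p.2) :
    pairGraph E ≤ G := by
  intro a b hab
  rcases hab.2 with h' | h'
  · exact h _ h'
  · exact (h _ h').symm

theorem pairGraph_adj {E : Finset (V × V)} {a b : V} (hab : a ≠ b) (h : (a, b) ∈ E) :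
    (pairGraph E).Adj a b := ⟨hab, .inl h⟩

theorem pairGraph_mono {E E' : Finset (V × V)} (h : E ⊆ E') : pairGraph E ≤ pairGraph E' :=
  fun _ _ hab => ⟨hab.1, hab.2.imp (fun x => h x) (fun x => h x)⟩

variable [DecidableEq V]

open Classical in
/-- The edges of a walk of length at most `ℓ` in the graph `K`, if there is such a walk. -/
def walkPairs (K : SimpleGraph V) (ℓ : ℕ) (u v : V) : Finset (V × V) :=
  if h : Near K u v ℓ then (h.choose.darts.map fun d => d.toProd).toFinset else ∅

theorem card_walkPairs_le (K : SimpleGraph V) (ℓ : ℕ) (u v : V) :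
    (walkPairs K ℓ u v).card ≤ ℓ := by
  unfold walkPairs
  split_ifs with h
  · refine (List.toFinset_card_le _).trans ?_
    simpa using h.choose_spec
  · simp

theorem adj_of_mem_walkPairs {K : SimpleGraph V} {ℓ : ℕ} {u v : V} {p : V × V}
    (hp : p ∈ walkPairs K ℓ u v) : K.Adj p.1 p.2 := by
  unfold walkPairs at hp
  split_ifs at hp with h
  · simp only [List.mem_toFinset, List.mem_map] at hp
    obtain ⟨d, -, rfl⟩ := hp
    exact d.adj
  · simp at hp

theorem near_pairGraph_walkPairs {K : SimpleGraph V} {ℓ : ℕ} {u v : V} (h : Near K u v ℓ) :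
    Near (pairGraph (walkPairs K ℓ u v)) u v ℓ := by
  have key : ∀ e ∈ h.choose.edges, e ∈ (pairGraph (walkPairs K ℓ u v)).edgeSet := by
    intro e he
    rw [SimpleGraph.Walk.edges, List.mem_map] at he
    obtain ⟨d, hd, rfl⟩ := he
    refine pairGraph_adj d.adj.ne ?_
    rw [walkPairs, dif_pos h, List.mem_toFinset]
    exact List.mem_map.2 ⟨d, hd, rfl⟩
  exact ⟨h.choose.transfer _ key, by simpa using h.choose_spec⟩

end

open Classical in
/-- The answer read off a stored subgraph `K`: shortest walks in `K`. -/
def subgraphOutput {n : ℕ} (K : SimpleGraph (Fin n)) (u v : Fin n) : Option (List (Fin n)) :=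
  if h : K.Reachable u v then some h.exists_walk_length_eq_dist.choose.support else none

/-- Walks of `K` are walks of `G`, so nothing unconnected is reported as connected; the hypothesis,
asked for every walk of `G`, also yields reachability in `K`. -/
theorem isApproxAPSP_subgraphOutput {n : ℕ} {G K : SimpleGraph (Fin n)} (hK : K ≤ G) {α β : ℝ}
    (h : ∀ u v (p : G.Walk u v), ∃ q : K.Walk u v, (q.length : ℝ) ≤ α * p.length + β) :
    IsApproxAPSP G α β (subgraphOutput K) := by
  intro u v
  constructor
  · intro huv
    obtain ⟨p, hp⟩ := huv.exists_walk_length_eq_dist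
    obtain ⟨q, hq⟩ := h u v p
    have hr : K.Reachable u v := ⟨q⟩
    refine ⟨hr.exists_walk_length_eq_dist.choose.mapLe hK, ?_, ?_⟩
    · rw [subgraphOutput, dif_pos hr]
      simp
    · rw [← hp]
      refine le_trans ?_ hq
      rw [SimpleGraph.Walk.length_mapLe, hr.exists_walk_length_eq_dist.choose_spec]
      exact_mod_cast SimpleGraph.dist_le q
  · intro huv
    rw [subgraphOutput, dif_neg fun h' => huv (h'.mono hK)]

/-- A subgraph `K` that contains short walks from all vertices to close centers of each level, and
short walks between a center and the close centers of its level unless there is a center of the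
next level nearby, approximates all walks of `G`. -/
theorem exists_walk_of_hierarchy {V : Type*} {G K : SimpleGraph V} (hK : K ≤ G) {ε : ℝ}
    (hε : 0 < ε) {ℓ : ℕ} {A : ℕ → Set V} {r L R : ℕ → ℕ} (hA0 : A 0 = Set.univ) (hAℓ : A ℓ = ∅)
    (hr : ∀ i, r (i + 1) = r i + 2 * R i) (hR : ∀ i, R i = 2 * (L i + r i))
    (hL : ∀ i, 1 ≤ L i) (hLr : ∀ i, (4 * r i : ℝ) ≤ (1 + ε) * L i)
    (hforest : ∀ i < ℓ, ∀ d ≤ R i, ∀ y, (∃ a ∈ A i, Near G y a d) → ∃ a ∈ A i, Near K y a d)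
    (hinter : ∀ i < ℓ, ∀ c ∈ A i, (∀ w ∈ A i, Near G c w (R i) → Near K c w (R i)) ∨
      ∃ a ∈ A (i + 1), Near G c a (2 * R i))
    {u v : V} (p : G.Walk u v) :
    ∃ q : K.Walk u v, (q.length : ℝ) ≤ (4 + ε) * p.length + r ℓ := by
  have hrmono : Monotone r := monotone_nat_of_le_succ fun i => by rw [hr]; omega
  induction hd : p.length using Nat.strong_induction_on generalizing u with
  | _ d ih =>
  -- Closeness to the centers holds at level `0`, where `u` is itself a center, and fails at level
  -- `ℓ`, where there are none; so it breaks somewhere.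
  obtain ⟨i, hi, hPi, hPi'⟩ : ∃ i < ℓ, (∃ a ∈ A i, Near G u a (r i)) ∧
      ¬ ∃ a ∈ A (i + 1), Near G u a (r (i + 1)) := by
    by_contra! hcon
    have : ∀ i ≤ ℓ, ∃ a ∈ A i, Near G u a (r i) := by
      intro i
      induction i with
      | zero => exact fun _ => ⟨u, by simp [hA0], .refl _ _ _⟩
      | succ i ih' => exact fun hi => hcon i hi (ih' (by omega))
    obtain ⟨a, ha, -⟩ := this ℓ le_rfl
    simp [hAℓ] at ha
  have hRi := hR i
  obtain ⟨c, hc, huc⟩ := hforest i hi (r i) (by omega) u hPi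
  have hcc : ∀ w ∈ A i, Near G c w (R i) → Near K c w (R i) := by
    rcases hinter i hi c hc with h | ⟨a, ha, hca⟩
    · exact h
    · exact absurd ⟨a, ha, by rw [hr]; exact (huc.map_le hK).trans hca⟩ hPi'
  -- Route `u → c → c' → u'` of length `r i + R i + (L i + r i)`; the depth `R i` is just the bound
  -- for the distance of `c` and `c'`.
  have jump : ∀ u', Near G u u' (L i) → Near K u u' (3 * L i + 4 * r i) := by
    intro u' hu'
    obtain ⟨c', hc', hu'c'⟩ := hforest i hi (L i + r i) (by omega) u'
      ⟨c, hc, hu'.symm.trans (huc.map_le hK)⟩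
    have h1 : Near G c c' (R i) :=
      (((huc.map_le hK).symm.trans hu').trans (hu'c'.map_le hK)).mono (by omega)
    exact ((huc.trans (hcc c' hc' h1)).trans hu'c'.symm).mono (by omega)
  by_cases hd' : d ≤ L i
  · obtain ⟨q, hq⟩ := jump v ⟨p, by omega⟩
    refine ⟨q, ?_⟩
    -- A walk shorter than one jump is charged to the additive term, since `r (i + 1) = 5 * r i + 4
    -- * L i`.
    have h1 : 3 * L i + 4 * r i ≤ r (i + 1) := by rw [hr, hRi]; omega
    have h2 : r (i + 1) ≤ r ℓ := hrmono hi
    have h3 : (q.length : ℝ) ≤ r ℓ := by exact_mod_cast (hq.trans (h1.trans h2))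
    have h4 : (0 : ℝ) ≤ (4 + ε) * d := by positivity
    linarith
  · have hLi := hL i
    obtain ⟨q₁, hq₁⟩ := jump (p.getVert (L i)) ⟨p.take (L i), by
      rw [SimpleGraph.Walk.take_length]; omega⟩
    have hlen : (p.drop (L i)).length = d - L i := by
      rw [SimpleGraph.Walk.drop_length, hd]
    obtain ⟨q₂, hq₂⟩ := ih (d - L i) (by omega) (p.drop (L i)) hlen
    refine ⟨q₁.append q₂, ?_⟩
    rw [SimpleGraph.Walk.length_append]
    have h1 : (q₁.length : ℝ) ≤ 3 * L i + 4 * r i := by exact_mod_cast hq₁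
    have h2 := hLr i
    rw [Nat.cast_sub (by omega)] at hq₂
    push_cast
    linarith

end

section

/-! ### Capped detection of close sources -/

section

variable {V : Type*} [DecidableEq V]

/-- The alternative at the end is the source of all completeness statements: a table misses
something only if it is full. -/
theorem exists_grow (r : ℕ) (X Y : Finset V) :
    ∃ N, X ⊆ N ∧ N ⊆ X ∪ Y ∧ N.card ≤ max r X.card ∧ (Y ⊆ N ∨ r ≤ N.card) := by
  rcases le_total (X ∪ Y).card r with h | h
  · exact ⟨X ∪ Y, Finset.subset_union_left, subset_rfl, le_max_of_le_left h,
      .inl Finset.subset_union_right⟩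
  · rcases le_total r X.card with h' | h'
    · exact ⟨X, subset_rfl, Finset.subset_union_left, le_max_right _ _, .inr h'⟩
    · obtain ⟨N, h1, h2, h3⟩ :=
        Finset.exists_subsuperset_card_eq (Finset.subset_union_left (s₂ := Y)) h' h
      exact ⟨N, h1, h2, le_max_of_le_left h3.le, .inr h3.ge⟩

/-- Elements of `Y` are added to `X` as long as there are fewer than `r`. -/
def grow (r : ℕ) (X Y : Finset V) : Finset V := (exists_grow r X Y).choose

theorem subset_grow (r : ℕ) (X Y : Finset V) : X ⊆ grow r X Y :=
  (exists_grow r X Y).choose_spec.1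

theorem grow_subset (r : ℕ) (X Y : Finset V) : grow r X Y ⊆ X ∪ Y :=
  (exists_grow r X Y).choose_spec.2.1

theorem card_grow_le (r : ℕ) (X Y : Finset V) : (grow r X Y).card ≤ max r X.card :=
  (exists_grow r X Y).choose_spec.2.2.1

theorem subset_grow_or (r : ℕ) (X Y : Finset V) : Y ⊆ grow r X Y ∨ r ≤ (grow r X Y).card :=
  (exists_grow r X Y).choose_spec.2.2.2

/-- The vertex `b` learns from its neighbor `a` about sources, and notes the edge if there is
something new. -/
def relax (r : ℕ) (old : V → Finset V) (a b : V) (z : (V → Finset V) × Finset (V × V)) :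
    (V → Finset V) × Finset (V × V) :=
  if grow r (z.1 b) (old a) = z.1 b then z
  else (Function.update z.1 b (grow r (z.1 b) (old a)), insert (a, b) z.2)

/-- What holds while a round of detection is reading the stream, with `P` the relation of pairs
already read. -/
structure RoundInv [Fintype V] (G : SimpleGraph V) (r : ℕ) (old : V → Finset V)
    (E₀ : Finset (V × V)) (P : V → V → Prop) (z : (V → Finset V) × Finset (V × V)) : Prop where
  sub : ∀ y, old y ⊆ z.1 y
  src : ∀ y w, w ∈ z.1 y → w ∈ old y ∨ ∃ x, (x, y) ∈ z.2 ∧ w ∈ old x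
  card : ∀ y, (z.1 y).card ≤ r
  mono : E₀ ⊆ z.2
  adj : ∀ p ∈ z.2, G.Adj p.1 p.2
  count : z.2.card + ∑ y, (old y).card ≤ E₀.card + ∑ y, (z.1 y).card
  full : ∀ x y, P x y → old x ⊆ z.1 y ∨ r ≤ (z.1 y).card

/-- An edge is stored only when the table of `b` grows strictly, so the total table size pays for
it. Sources are copied from the frozen tables `old`, hence one pass advances by exactly one edge. -/
theorem RoundInv.relax [Fintype V] {G : SimpleGraph V} {r : ℕ} {old : V → Finset V}
    {E₀ : Finset (V × V)} {P : V → V → Prop} {z : (V → Finset V) × Finset (V × V)}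
    (h : RoundInv G r old E₀ P z) {a b : V} (hab : G.Adj a b) :
    RoundInv G r old E₀ (fun x y => P x y ∨ (x = a ∧ y = b)) (relax r old a b z) := by
  unfold Streaming.relax
  have hor := subset_grow_or r (z.1 b) (old a)
  split_ifs with hN
  · rw [hN] at hor
    refine ⟨h.sub, h.src, h.card, h.mono, h.adj, h.count, ?_⟩
    rintro x y (hP | ⟨rfl, rfl⟩)
    · exact h.full x y hP
    · exact hor
  · have hsub := subset_grow r (z.1 b) (old a)
    have hsub' : ∀ y, z.1 y ⊆ Function.update z.1 b (grow r (z.1 b) (old a)) y := by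
      intro y
      by_cases hy : y = b
      · subst hy; simpa using hsub
      · simp [hy]
    refine ⟨fun y => (h.sub y).trans (hsub' y), ?_, ?_, h.mono.trans (Finset.subset_insert _ _),
      ?_, ?_, ?_⟩
    · intro y w hw
      have base : w ∈ z.1 y → w ∈ old y ∨ ∃ x, (x, y) ∈ insert (a, b) z.2 ∧ w ∈ old x := by
        intro hw
        rcases h.src y w hw with h1 | ⟨x, h1, h2⟩
        · exact .inl h1
        · exact .inr ⟨x, Finset.mem_insert_of_mem h1, h2⟩
      by_cases hy : y = b
      · subst hy
        simp only [Function.update_self] at hw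
        rcases Finset.mem_union.1 (grow_subset _ _ _ hw) with h1 | h1
        · exact base h1
        · exact .inr ⟨a, Finset.mem_insert_self _ _, h1⟩
      · simp only [Function.update_of_ne hy] at hw
        exact base hw
    · intro y
      by_cases hy : y = b
      · subst hy
        simp only [Function.update_self]
        have := card_grow_le r (z.1 y) (old a)
        rwa [max_eq_left (h.card y)] at this
      · simpa [Function.update_of_ne hy] using h.card y
    · intro p hp
      rcases Finset.mem_insert.1 hp with rfl | hp
      · exact hab
      · exact h.adj p hp
    · have h1 : (insert (a, b) z.2).card ≤ z.2.card + 1 := Finset.card_insert_le _ _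
      have h2 : ∑ y, (z.1 y).card <
          ∑ y, (Function.update z.1 b (grow r (z.1 b) (old a)) y).card := by
        refine Finset.sum_lt_sum (fun y _ => Finset.card_le_card (hsub' y))
          ⟨b, Finset.mem_univ _, ?_⟩
        simp only [Function.update_self]
        exact Finset.card_lt_card (hsub.ssubset_of_ne (Ne.symm hN))
      have := h.count
      dsimp only
      omega
    · rintro x y (hP | ⟨rfl, rfl⟩)
      · rcases h.full x y hP with h1 | h1
        · exact .inl (h1.trans (hsub' y))
        · exact .inr (h1.trans (Finset.card_le_card (hsub' y)))
      · simpa using hor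

/-- Both end vertices of an edge learn from each other. -/
def readEdge (r : ℕ) (old : V → Finset V) (z : (V → Finset V) × Finset (V × V)) (e : Sym2 V) :
    (V → Finset V) × Finset (V × V) :=
  relax r old (Quot.out e).2 (Quot.out e).1 (relax r old (Quot.out e).1 (Quot.out e).2 z)

omit [DecidableEq V] in
theorem RoundInv.mono_rel [Fintype V] {G : SimpleGraph V} {r : ℕ} {old : V → Finset V}
    {E₀ : Finset (V × V)} {P Q : V → V → Prop} {z : (V → Finset V) × Finset (V × V)}
    (h : RoundInv G r old E₀ P z) (hPQ : ∀ x y, Q x y → P x y) : RoundInv G r old E₀ Q z :=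
  { h with full := fun x y hq => h.full x y (hPQ x y hq) }

theorem RoundInv.readEdge [Fintype V] {G : SimpleGraph V} {r : ℕ} {old : V → Finset V}
    {E₀ : Finset (V × V)} {P : V → V → Prop} {z : (V → Finset V) × Finset (V × V)}
    (h : RoundInv G r old E₀ P z) {e : Sym2 V} (he : e ∈ G.edgeSet) :
    RoundInv G r old E₀ (fun x y => P x y ∨ s(x, y) = e) (readEdge r old z e) := by
  have hout : s((Quot.out e).1, (Quot.out e).2) = e := Quot.out_eq e
  have hadj : G.Adj (Quot.out e).1 (Quot.out e).2 := by
    rw [← SimpleGraph.mem_edgeSet, hout]; exact he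
  refine ((h.relax hadj).relax hadj.symm).mono_rel ?_
  rintro x y (hP | hxy)
  · exact .inl (.inl hP)
  · rw [← hout, Sym2.eq_iff] at hxy
    rcases hxy with h1 | h1
    · exact .inl (.inr h1)
    · exact .inr h1

theorem RoundInv.foldl [Fintype V] {G : SimpleGraph V} {r : ℕ} {old : V → Finset V}
    {E₀ : Finset (V × V)} (hcard : ∀ y, (old y).card ≤ r) (hadj : ∀ p ∈ E₀, G.Adj p.1 p.2)
    (l : List (Sym2 V)) (hl : ∀ e ∈ l, e ∈ G.edgeSet) :
    RoundInv G r old E₀ (fun x y => s(x, y) ∈ l) (l.foldl (Streaming.readEdge r old) (old, E₀)) := by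
  induction l using List.reverseRecOn with
  | nil =>
    exact ⟨fun _ => subset_rfl, fun _ _ h => .inl h, hcard, subset_rfl, hadj, le_rfl, by simp⟩
  | append_singleton l e ih =>
    rw [List.foldl_append]
    refine ((ih fun e he => hl e (by simp [he])).readEdge (hl e (by simp))).mono_rel ?_
    intro x y h
    simpa using h

/-- What capped detection knows after `d` rounds, for the source set `S`: `T y` holds the sources
known to `y`, and `E` the edges on which they were learned. -/
structure DetectInv [Fintype V] (G : SimpleGraph V) (r : ℕ) (S : Finset V) (d : ℕ)
    (T : V → Finset V) (E : Finset (V × V)) : Prop where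
  sound : ∀ y w, w ∈ T y → w ∈ S ∧ Near (pairGraph E) y w d
  card : ∀ y, (T y).card ≤ r
  complete : ∀ y w, w ∈ S → Near G y w d → w ∈ T y ∨ r ≤ (T y).card
  adj : ∀ p ∈ E, G.Adj p.1 p.2
  count : E.card ≤ ∑ y, (T y).card
  nearest : ∀ d' ≤ d, ∀ y, (∃ w ∈ S, Near G y w d') → ∃ w ∈ S, Near (pairGraph E) y w d'

theorem DetectInv.zero [Fintype V] (G : SimpleGraph V) {r : ℕ} (hr : 1 ≤ r) (S : Finset V) :
    DetectInv G r S 0 (fun y => if y ∈ S then {y} else ∅) ∅ where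
  sound y w hw := by
    split_ifs at hw with h
    · rw [Finset.mem_singleton] at hw
      subst hw
      exact ⟨h, .refl _ _ _⟩
    · simp at hw
  card y := by
    split_ifs <;> simp [hr]
  complete y w hw h := by
    have := h.zero
    subst this
    simp [hw]
  adj := by simp
  count := by simp
  nearest d' hd y := by
    rintro ⟨w, hw, h⟩
    obtain rfl : d' = 0 := by omega
    exact ⟨w, hw, by rw [h.zero]; exact .refl _ _ _⟩

-- A source at distance `d + 1` is at distance `d` from a neighbor. Either that neighbor knew it and
-- passed it on, or one of the two tables is full, and then so is the new one.
omit [DecidableEq V] in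
theorem DetectInv.succ [Fintype V] {G : SimpleGraph V} {r : ℕ} (hr : 1 ≤ r) {S : Finset V} {d : ℕ}
    {T : V → Finset V} {E : Finset (V × V)} (h : DetectInv G r S d T E) {P : V → V → Prop}
    (hP : ∀ x y, G.Adj x y → P x y) {z : (V → Finset V) × Finset (V × V)}
    (hz : RoundInv G r T E P z) : DetectInv G r S (d + 1) z.1 z.2 := by
  have hE := pairGraph_mono hz.mono
  have sound : ∀ y w, w ∈ z.1 y → w ∈ S ∧ Near (pairGraph z.2) y w (d + 1) := by
    intro y w hw
    rcases hz.src y w hw with h1 | ⟨x, hx, hwx⟩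
    · exact ⟨(h.sound y w h1).1, ((h.sound y w h1).2.map_le hE).mono (Nat.le_succ d)⟩
    · obtain ⟨h1, h2⟩ := h.sound x w hwx
      have hadj := hz.adj _ hx
      refine ⟨h1, ?_⟩
      have := (Near.of_adj (pairGraph_adj hadj.ne hx)).symm.trans (h2.map_le hE)
      rwa [add_comm] at this
  have complete : ∀ y w, w ∈ S → Near G y w (d + 1) → w ∈ z.1 y ∨ r ≤ (z.1 y).card := by
    intro y w hw hn
    have aux : ∀ x, T x ⊆ z.1 y ∨ r ≤ (z.1 y).card → Near G x w d →
        w ∈ z.1 y ∨ r ≤ (z.1 y).card := by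
      intro x hx hn
      rcases hx with hx | hx
      · rcases h.complete x w hw hn with h1 | h1
        · exact .inl (hx h1)
        · exact .inr (h1.trans (Finset.card_le_card hx))
      · exact .inr hx
    rcases hn.exists_adj with rfl | ⟨x, hx, hn⟩
    · exact aux y (.inl (hz.sub y)) (.refl _ _ _)
    · exact aux x (hz.full x y (hP x y hx.symm)) hn
  refine ⟨sound, hz.card, complete, hz.adj, ?_, ?_⟩
  · have := hz.count
    have := h.count
    omega
  · rintro d' hd' y ⟨w, hw, hn⟩
    rcases Nat.le_succ_iff.1 hd' with hd' | rfl
    · obtain ⟨w', hw', hn'⟩ := h.nearest d' hd' y ⟨w, hw, hn⟩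
      exact ⟨w', hw', hn'.map_le hE⟩
    -- A full table is not empty since `1 ≤ r`, and by soundness any entry serves as the source
    -- nearby; thus even cap `1` produces a BFS forest.
    · rcases complete y w hw hn with h1 | h1
      · exact ⟨w, sound y w h1⟩
      · obtain ⟨w', hw'⟩ := Finset.card_pos.1 (lt_of_lt_of_le hr h1)
        exact ⟨w', sound y w' hw'⟩

end

/-! ### The program -/

/-- The state of the program. -/
@[ext]
structure State (n : ℕ) where
  /-- the centers of the current level -/
  centers : Finset (Fin n)
  /-- the edges stored for the answer -/
  kept : Finset (Fin n × Fin n)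
  /-- the edges on which the current detection has learned something -/
  found : Finset (Fin n × Fin n)
  /-- the sources known before the current round -/
  old : Fin n → Finset (Fin n)
  /-- the sources known now -/
  new : Fin n → Finset (Fin n)
  /-- for each center the close centers found so far -/
  known : Fin n → Finset (Fin n)

variable {n : ℕ}

/-- The lists that represent a state. -/
def State.code (x : State n) : List (List (Fin n)) :=
  x.centers.toList :: x.kept.toList.map Prod.fst :: x.kept.toList.map Prod.snd ::
    x.found.toList.map Prod.fst :: x.found.toList.map Prod.snd ::
    (List.ofFn (fun y => (x.old y).toList) ++ (List.ofFn (fun y => (x.new y).toList) ++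
      List.ofFn (fun y => (x.known y).toList)))

theorem finset_toList_inj {α : Type*} {s t : Finset α} (h : s.toList = t.toList) : s = t := by
  ext a
  rw [← Finset.mem_toList, h, Finset.mem_toList]

theorem list_eq_of_map_fst_snd {α β : Type*} {l l' : List (α × β)}
    (h₁ : l.map Prod.fst = l'.map Prod.fst) (h₂ : l.map Prod.snd = l'.map Prod.snd) : l = l' := by
  rw [← List.zip_unzip l, ← List.zip_unzip l', List.unzip_eq_map, List.unzip_eq_map, h₁, h₂]

theorem State.code_injective : Function.Injective (State.code (n := n)) := by
  intro x y h
  simp only [State.code, List.cons.injEq] at h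
  obtain ⟨h1, h2, h3, h4, h5, h6⟩ := h
  obtain ⟨h6, h7⟩ := List.append_inj h6 (by simp)
  obtain ⟨h7, h8⟩ := List.append_inj h7 (by simp)
  have aux : ∀ {f g : Fin n → Finset (Fin n)},
      List.ofFn (fun y => (f y).toList) = List.ofFn (fun y => (g y).toList) → f = g := by
    intro f g hfg
    funext a
    exact finset_toList_inj (congrFun (List.ofFn_injective hfg) a)
  exact State.ext (finset_toList_inj h1) (finset_toList_inj (list_eq_of_map_fst_snd h2 h3))
    (finset_toList_inj (list_eq_of_map_fst_snd h4 h5)) (aux h6) (aux h7) (aux h8)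

/-- The number of words used for a state. -/
def State.cost (x : State n) : ℕ := listsCost x.code

theorem State.cost_eq (x : State n) :
    x.cost = x.centers.card + 2 * x.kept.card + 2 * x.found.card + ∑ y, (x.old y).card +
      ∑ y, (x.new y).card + ∑ y, (x.known y).card + 3 * n + 5 := by
  simp [State.cost, State.code, listsCost, List.map_ofFn, List.sum_ofFn, Function.comp_def,
    Finset.sum_add_distrib]
  ring

/-- Bounds for the parts of a state. -/
structure Fits (r B : ℕ) (x : State n) : Prop where
  old : ∀ y, (x.old y).card ≤ r
  new : ∀ y, (x.new y).card ≤ r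
  found : x.found.card ≤ n * r
  kept : x.kept.card ≤ B
  known : ∑ y, (x.known y).card ≤ B

/-- The number of words that suffice for a state with the given bounds. -/
def memoryBound (n r B : ℕ) : ℕ := 4 * (n * r) + 3 * B + 4 * n + 5

theorem Fits.cost_le {r B : ℕ} {x : State n} (h : Fits r B x) : x.cost ≤ memoryBound n r B := by
  have h1 : ∑ y, (x.old y).card ≤ n * r := by
    simpa using Finset.sum_le_card_nsmul Finset.univ _ r fun y _ => h.old y
  have h2 : ∑ y, (x.new y).card ≤ n * r := by
    simpa using Finset.sum_le_card_nsmul Finset.univ _ r fun y _ => h.new y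
  have h3 : x.centers.card ≤ n := by simpa using Finset.card_le_univ x.centers
  have := h.found
  have := h.kept
  have := h.known
  rw [State.cost_eq, memoryBound]
  omega

/-- Run from `x`, the program stays within the memory bound `M` and ends in a state with the
property `Q`. -/
def Achieves (M : ℕ) (s : List (Sym2 (Fin n))) (p : List (Pass n (State n))) (x : State n)
    (Q : State n → Prop) : Prop :=
  BoundedBy State.cost M s p x ∧ Q (runProgram s p x)

theorem Achieves.append {M : ℕ} {s : List (Sym2 (Fin n))} {p q : List (Pass n (State n))}
    {x : State n} {Q Q' : State n → Prop} (hp : Achieves M s p x Q)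
    (hq : ∀ y, Q y → Achieves M s q y Q') : Achieves M s (p ++ q) x Q' := by
  have h := hq _ hp.2
  refine ⟨hp.1.append h.1, ?_⟩
  rw [runProgram_append]
  exact h.2

theorem achieves_localPass {M : ℕ} {s : List (Sym2 (Fin n))} {f : State n → State n}
    {x : State n} {Q : State n → Prop} (hx : x.cost ≤ M) (hf : (f x).cost ≤ M) (hQ : Q (f x)) :
    Achieves M s [localPass f] x Q := by
  refine ⟨⟨fun l _ => by rwa [foldl_localPass_step], ?_⟩, ?_⟩
  · rw [localPass_apply]; exact hf
  · simp only [runProgram, localPass_apply]; exact hQ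

/-- Start a detection from the centers in `S`. -/
def load (S : Finset (Fin n)) (x : State n) : State n :=
  { x with
    found := ∅
    old := fun y => if y ∈ x.centers ∩ S then {y} else ∅
    new := fun y => if y ∈ x.centers ∩ S then {y} else ∅ }

/-- A round of detection with cap `r`. -/
def roundPass (r : ℕ) : Pass n (State n) where
  step x e := { x with
    new := (readEdge r x.old (x.new, x.found) e).1
    found := (readEdge r x.old (x.new, x.found) e).2 }
  fin x := { x with old := x.new }

theorem foldl_roundPass_step (r : ℕ) (l : List (Sym2 (Fin n))) (x : State n) :
    l.foldl (roundPass r).step x = { x with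
      new := (l.foldl (readEdge r x.old) (x.new, x.found)).1
      found := (l.foldl (readEdge r x.old) (x.new, x.found)).2 } := by
  induction l generalizing x with
  | nil => rfl
  | cons e l ih => rw [List.foldl_cons, ih]; rfl

/-- Detection to depth `R` with cap `r` from the centers in `S`. -/
def detect (r R : ℕ) (S : Finset (Fin n)) : List (Pass n (State n)) :=
  [localPass (load S)] ++ List.replicate R (roundPass r)

theorem DetectInv.card_le {G : SimpleGraph (Fin n)} {r d : ℕ} {S : Finset (Fin n)}
    {T : Fin n → Finset (Fin n)} {E : Finset (Fin n × Fin n)} (h : DetectInv G r S d T E) :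
    E.card ≤ n * r :=
  h.count.trans (by simpa using Finset.sum_le_card_nsmul Finset.univ _ r fun y _ => h.card y)

/-- The state after `d` rounds of a detection that began in the state `x`. -/
structure Detected (G : SimpleGraph (Fin n)) (r d : ℕ) (S : Finset (Fin n)) (x y : State n) :
    Prop where
  centers : y.centers = x.centers
  kept : y.kept = x.kept
  known : y.known = x.known
  new : y.new = y.old
  inv : DetectInv G r (x.centers ∩ S) d y.old y.found

theorem Detected.fits {G : SimpleGraph (Fin n)} {r q d B : ℕ} {S : Finset (Fin n)} {x y : State n}
    (h : Detected G r d S x y) (hrq : r ≤ q) (hx : Fits q B x) : Fits q B y :=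
  ⟨fun a => (h.inv.card a).trans hrq, fun a => by rw [h.new]; exact (h.inv.card a).trans hrq,
    h.inv.card_le.trans (Nat.mul_le_mul_left _ hrq), by rw [h.kept]; exact hx.kept,
    by rw [h.known]; exact hx.known⟩

theorem Detected.round {G : SimpleGraph (Fin n)} {s : List (Sym2 (Fin n))}
    (hs : IsEdgeStream G s) {r q d B : ℕ} (hr : 1 ≤ r) (hrq : r ≤ q) {S : Finset (Fin n)}
    {x y : State n} (h : Detected G r d S x y) (hx : Fits q B x) :
    Achieves (memoryBound n q B) s [roundPass r] y (Detected G r (d + 1) S x) := by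
  have hround : ∀ l, l <+: s → RoundInv G r y.old y.found (fun a b => s(a, b) ∈ l)
      (l.foldl (readEdge r y.old) (y.new, y.found)) := by
    intro l hl
    rw [h.new]
    exact RoundInv.foldl h.inv.card h.inv.adj l fun e he => (hs.2 e).1 (hl.subset he)
  have hfin : Detected G r (d + 1) S x ((roundPass r).apply s y) := by
    rw [Pass.apply, foldl_roundPass_step]
    exact ⟨h.centers, h.kept, h.known, rfl,
      h.inv.succ hr (fun a b hab => (hs.2 _).2 hab) (hround s List.prefix_rfl)⟩
  refine ⟨⟨fun l hl => ?_, (hfin.fits hrq hx).cost_le⟩, hfin⟩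
  rw [foldl_roundPass_step]
  have hR := hround l hl
  refine Fits.cost_le ⟨fun a => (h.inv.card a).trans hrq, fun a => (hR.card a).trans hrq, ?_, by rw [h.kept]; exact hx.kept,
    by rw [h.known]; exact hx.known⟩
  have h1 : ∑ a, ((l.foldl (readEdge r y.old) (y.new, y.found)).1 a).card ≤ n * r := by
    simpa using Finset.sum_le_card_nsmul Finset.univ _ r fun a _ => hR.card a
  have h2 := hR.count
  have h3 := h.inv.count
  refine le_trans ?_ (Nat.mul_le_mul_left n hrq)
  dsimp only
  omega

theorem achieves_detect {G : SimpleGraph (Fin n)} {s : List (Sym2 (Fin n))}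
    (hs : IsEdgeStream G s) {r q B : ℕ} (hr : 1 ≤ r) (hrq : r ≤ q) (R : ℕ)
    (S : Finset (Fin n)) {x : State n} (hx : Fits q B x) :
    Achieves (memoryBound n q B) s (detect r R S) x (Detected G r R S x) := by
  induction R with
  | zero =>
    have h0 : Detected G r 0 S x (load S x) := ⟨rfl, rfl, rfl, rfl, .zero G hr _⟩
    exact achieves_localPass hx.cost_le (h0.fits hrq hx).cost_le h0
  | succ R ih =>
    rw [detect, List.replicate_succ', ← List.append_assoc]
    exact Achieves.append ih fun y hy => hy.round hs hr hrq hx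

end

section

/-! ### One level of the hierarchy -/

variable {n : ℕ}

/-- Every element of a set of at most `t` vertices lies in a member of the family that contains at
most `r` elements of this set. -/
def Selective (t r : ℕ) (F : List (Finset (Fin n))) : Prop :=
  ∀ T : Finset (Fin n), T.card ≤ t → ∀ w ∈ T, ∃ S ∈ F, w ∈ S ∧ (S ∩ T).card ≤ r

/-- Store all edges of the last detection. -/
def keep (x : State n) : State n := { x with kept := x.kept ∪ x.found }

/-- The edges of walks from a center to the close centers that are new to it. -/
def newWalks (t R : ℕ) (x : State n) : Finset (Fin n × Fin n) :=
  x.centers.biUnion fun c => if (x.known c).card < t then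
    (x.old c \ x.known c).biUnion (walkPairs (pairGraph x.found) R c) else ∅

/-- Centers with few known close centers learn what the last detection has found, and store walks
to the new ones. -/
def absorb (t R : ℕ) (x : State n) : State n :=
  { x with
    kept := x.kept ∪ newWalks t R x
    known := fun c =>
      if c ∈ x.centers ∧ (x.known c).card < t then x.known c ∪ x.old c else x.known c }

/-- Greedy choice: an element is taken unless its set meets the set of one already taken. -/
theorem exists_disjoint_subfamily {V : Type*} [DecidableEq V] (D : V → Finset V) (P : Finset V) :
    ∃ Q ⊆ P, (∀ c ∈ Q, ∀ c' ∈ Q, c ≠ c' → Disjoint (D c) (D c')) ∧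
      ∀ c ∈ P, c ∈ Q ∨ ∃ q ∈ Q, ¬ Disjoint (D c) (D q) := by
  induction P using Finset.induction_on with
  | empty => exact ⟨∅, by simp⟩
  | insert a P ha ih =>
    obtain ⟨Q, h1, h2, h3⟩ := ih
    by_cases h : ∃ q ∈ Q, ¬ Disjoint (D a) (D q)
    · refine ⟨Q, h1.trans (Finset.subset_insert _ _), h2, fun c hc => ?_⟩
      rcases Finset.mem_insert.1 hc with rfl | hc
      · exact .inr h
      · exact h3 c hc
    · push Not at h
      refine ⟨insert a Q, Finset.insert_subset_insert _ h1, ?_, fun c hc => ?_⟩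
      · intro c hc c' hc' hne
        rcases Finset.mem_insert.1 hc with rfl | hcQ
        · exact h c' (Finset.mem_of_mem_insert_of_ne hc' hne.symm)
        · rcases Finset.mem_insert.1 hc' with rfl | hcQ'
          · exact (h c hcQ).symm
          · exact h2 c hcQ c' hcQ' hne
      · rcases Finset.mem_insert.1 hc with rfl | hc
        · exact .inl (Finset.mem_insert_self _ _)
        · rcases h3 c hc with h' | ⟨q, hq, h'⟩
          · exact .inl (Finset.mem_insert_of_mem h')
          · exact .inr ⟨q, Finset.mem_insert_of_mem hq, h'⟩

/-- The centers of the next level: a maximal set of centers with at least `t` close centers that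
have no close center in common. -/
def nextCenters (t : ℕ) (x : State n) : Finset (Fin n) :=
  (exists_disjoint_subfamily x.known (x.centers.filter fun c => t ≤ (x.known c).card)).choose

/-- Go to the next level. -/
def advance (t : ℕ) (x : State n) : State n :=
  { x with centers := nextCenters t x, known := fun _ => ∅ }

/-- The known sets of the chosen centers are disjoint, lie among the current centers and have at
least `t` elements each. -/
theorem card_nextCenters_mul_le {t : ℕ} {x : State n} (h : ∀ c, x.known c ⊆ x.centers) :
    (nextCenters t x).card * t ≤ x.centers.card := by
  have hs := (exists_disjoint_subfamily x.known
    (x.centers.filter fun c => t ≤ (x.known c).card)).choose_spec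
  calc (nextCenters t x).card * t ≤ ∑ c ∈ nextCenters t x, (x.known c).card :=
        Finset.card_nsmul_le_sum _ _ _ fun c hc => (Finset.mem_filter.1 (hs.1 hc)).2
    _ = ((nextCenters t x).biUnion x.known).card :=
        (Finset.card_biUnion fun c hc c' hc' hne => hs.2.1 c hc c' hc' hne).symm
    _ ≤ x.centers.card := Finset.card_le_card (Finset.biUnion_subset.2 fun c _ => h c)

/-- By maximality a popular center shares a known center with a chosen one, and each of the two is
within `R` of it. -/
theorem exists_nextCenters_near {t : ℕ} {x : State n} {G : SimpleGraph (Fin n)}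
    {R : ℕ} (h : ∀ c, ∀ w ∈ x.known c, Near G c w R) {c : Fin n} (hc : c ∈ x.centers)
    (hct : t ≤ (x.known c).card) : ∃ a ∈ nextCenters t x, Near G c a (2 * R) := by
  have hs := (exists_disjoint_subfamily x.known
    (x.centers.filter fun c => t ≤ (x.known c).card)).choose_spec
  rcases hs.2.2 c (Finset.mem_filter.2 ⟨hc, hct⟩) with h1 | ⟨q, hq, h1⟩
  · exact ⟨c, h1, .refl _ _ _⟩
  · obtain ⟨w, hw, hw'⟩ := Finset.not_disjoint_iff.1 h1
    exact ⟨q, hq, ((h c w hw).trans (h q w hw').symm).mono (by omega)⟩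

/-- The detections of a level from the sets of a family, each with its harvest. -/
def sweep (t r R : ℕ) (F : List (Finset (Fin n))) : List (Pass n (State n)) :=
  F.flatMap fun S => detect r R S ++ [localPass (absorb t R)]

/-- The program for one level. -/
def levelProgram (t r R : ℕ) (F : List (Finset (Fin n))) : List (Pass n (State n)) :=
  detect 1 R Finset.univ ++ ([localPass keep] ++ (sweep t r R F ++ [localPass (advance t)]))

theorem length_detect (r R : ℕ) (S : Finset (Fin n)) : (detect r R S).length = R + 1 := by
  simp [detect]

theorem length_levelProgram (t r R : ℕ) (F : List (Finset (Fin n))) :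
    (levelProgram t r R F).length ≤ (F.length + 1) * (R + 3) := by
  have : (sweep t r R F).length = F.length * (R + 2) := by
    simp [sweep, List.length_flatMap, length_detect]
  simp only [levelProgram, List.length_append, length_detect, this, List.length_singleton]
  nlinarith [Nat.zero_le F.length]

/-- What holds after the detections from the sets in `F`, when `E` had been stored before. -/
structure SweepInv (G : SimpleGraph (Fin n)) (t r R : ℕ) (A : Finset (Fin n))
    (E : Finset (Fin n × Fin n)) (F : List (Finset (Fin n))) (x : State n) : Prop where
  centers : x.centers = A
  old : ∀ y, (x.old y).card ≤ r
  new : ∀ y, (x.new y).card ≤ r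
  found : x.found.card ≤ n * r
  sub : E ⊆ x.kept
  adj : ∀ p ∈ x.kept, G.Adj p.1 p.2
  known_sub : ∀ c, ∀ w ∈ x.known c, c ∈ A ∧ w ∈ A ∧ Near (pairGraph x.kept) c w R
  known_card : ∀ c, (x.known c).card ≤ t + r
  complete : ∀ S ∈ F, ∀ c ∈ A, (x.known c).card < t → ∀ w ∈ A ∩ S, Near G c w R →
    w ∈ x.known c ∨ r ≤ (S ∩ x.known c).card
  kept_card : x.kept.card ≤ E.card + R * ∑ c ∈ A, (x.known c).card

theorem SweepInv.sum_known_le {G : SimpleGraph (Fin n)} {t r R : ℕ} {A : Finset (Fin n)}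
    {E : Finset (Fin n × Fin n)} {F : List (Finset (Fin n))} {x : State n}
    (h : SweepInv G t r R A E F x) : ∑ c ∈ A, (x.known c).card ≤ A.card * (t + r) := by
  simpa using Finset.sum_le_card_nsmul A _ (t + r) fun c _ => h.known_card c

theorem SweepInv.fits {G : SimpleGraph (Fin n)} {t r R B : ℕ} {A : Finset (Fin n)}
    {E : Finset (Fin n × Fin n)} {F : List (Finset (Fin n))} {x : State n}
    (h : SweepInv G t r R A E F x) (hR : 1 ≤ R) (hB : E.card + A.card * (t + r) * R ≤ B) :
    Fits r B x := by
  have h1 := h.sum_known_le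
  refine ⟨h.old, h.new, h.found, ?_, ?_⟩
  · have := h.kept_card
    nlinarith
  · have h2 : ∑ c, (x.known c).card = ∑ c ∈ A, (x.known c).card := by
      refine (Finset.sum_subset (Finset.subset_univ A) fun c _ hc => ?_).symm
      rw [Finset.card_eq_zero, Finset.eq_empty_iff_forall_notMem]
      exact fun w hw => hc (h.known_sub c w hw).1
    rw [h2]
    nlinarith

/-- Each newly known center costs one walk of at most `R` edges, so `R` times the known pairs is a
potential for the stored edges. -/
theorem card_newWalks_le (t R : ℕ) (x : State n) :
    (newWalks t R x).card + R * ∑ c ∈ x.centers, (x.known c).card ≤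
      R * ∑ c ∈ x.centers, ((absorb t R x).known c).card := by
  have h1 : (newWalks t R x).card ≤ ∑ c ∈ x.centers,
      (if (x.known c).card < t then (x.old c \ x.known c).card * R else 0) := by
    refine Finset.card_biUnion_le.trans (Finset.sum_le_sum fun c _ => ?_)
    split_ifs
    · exact Finset.card_biUnion_le_card_mul _ _ _ fun w _ => card_walkPairs_le _ _ _ _
    · simp
  refine (Nat.add_le_add_right h1 _).trans ?_
  rw [Finset.mul_sum, Finset.mul_sum, ← Finset.sum_add_distrib]
  refine Finset.sum_le_sum fun c hc => ?_
  simp only [absorb, hc, true_and]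
  split_ifs
  · rw [Finset.union_comm, ← Finset.card_sdiff_add_card]
    exact le_of_eq (by ring)
  · simp

theorem SweepInv.absorb {G : SimpleGraph (Fin n)} {t r R : ℕ} {A : Finset (Fin n)}
    {E : Finset (Fin n × Fin n)} {F : List (Finset (Fin n))} {x y : State n}
    (h : SweepInv G t r R A E F x) {S : Finset (Fin n)} (hy : Detected G r R S x y) :
    SweepInv G t r R A E (F ++ [S]) (absorb t R y) := by
  have hA : y.centers = A := hy.centers.trans h.centers
  have hsubset : ∀ c, x.known c ⊆ (Streaming.absorb t R y).known c := by
    intro c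
    simp only [Streaming.absorb, hy.known]
    split_ifs
    · exact Finset.subset_union_left
    · exact subset_rfl
  have hfoundG : pairGraph y.found ≤ G := pairGraph_le hy.inv.adj
  refine ⟨hA, hy.inv.card, by rw [show (Streaming.absorb t R y).new = y.old from hy.new]; exact
    hy.inv.card, hy.inv.card_le, ?_, ?_, ?_, ?_, ?_, ?_⟩
  · simp only [Streaming.absorb, hy.kept]
    exact h.sub.trans Finset.subset_union_left
  · intro p hp
    simp only [Streaming.absorb, hy.kept, Finset.mem_union] at hp
    rcases hp with hp | hp
    · exact h.adj p hp
    · simp only [newWalks, Finset.mem_biUnion] at hp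
      obtain ⟨c, -, hp⟩ := hp
      split_ifs at hp
      · simp only [Finset.mem_biUnion] at hp
        obtain ⟨w, -, hp⟩ := hp
        exact hfoundG (adj_of_mem_walkPairs hp)
      · simp at hp
  · intro c w hw
    by_cases hwx : w ∈ x.known c
    · obtain ⟨h1, h2, h3⟩ := h.known_sub c w hwx
      refine ⟨h1, h2, h3.map_le (pairGraph_mono ?_)⟩
      simp only [Streaming.absorb, hy.kept]
      exact Finset.subset_union_left
    · simp only [Streaming.absorb, hA, hy.known] at hw
      split_ifs at hw with hc
      · have hwy : w ∈ y.old c := by simpa [hwx] using hw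
        obtain ⟨h1, h2⟩ := hy.inv.sound c w hwy
        rw [h.centers] at h1
        refine ⟨hc.1, (Finset.mem_inter.1 h1).1, ?_⟩
        refine (near_pairGraph_walkPairs h2).map_le (pairGraph_mono ?_)
        refine subset_trans ?_ (Finset.subset_union_right (s₁ := y.kept))
        intro p hp
        rw [newWalks, Finset.mem_biUnion]
        refine ⟨c, by rw [hA]; exact hc.1, ?_⟩
        rw [if_pos (by rw [hy.known]; exact hc.2), Finset.mem_biUnion]
        exact ⟨w, by simp [hwy, hy.known, hwx], hp⟩
      · exact absurd hw hwx
  · intro c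
    simp only [Streaming.absorb, hy.known]
    split_ifs with hc
    · refine (Finset.card_union_le _ _).trans (add_le_add hc.2.le (hy.inv.card c))
    · exact h.known_card c
  · intro S' hS' c hc hct w hw hn
    -- Known sets only grow, so a center below the threshold now was below it at every earlier
    -- harvest and skipped none.
    have hlt : (x.known c).card < t := (Finset.card_le_card (hsubset c)).trans_lt hct
    rcases List.mem_append.1 hS' with hS' | hS'
    · rcases h.complete S' hS' c hc hlt w hw hn with h1 | h1
      · exact .inl (hsubset c h1)
      · exact .inr (h1.trans (Finset.card_le_card (Finset.inter_subset_inter_left (hsubset c))))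
    · rw [List.mem_singleton] at hS'
      subst hS'
      have hk : (Streaming.absorb t R y).known c = x.known c ∪ y.old c := by
        simp only [Streaming.absorb, hA, hy.known, hc, hlt, and_self, if_true]
      rw [hk]
      rcases hy.inv.complete c w (by rw [h.centers]; exact hw) hn with h1 | h1
      · exact .inl (Finset.mem_union_right _ h1)
      · refine .inr (h1.trans (Finset.card_le_card fun v hv => ?_))
        exact Finset.mem_inter.2 ⟨(Finset.mem_inter.1 (hy.inv.sound c v hv).1).2,
          Finset.mem_union_right _ hv⟩
  · have h1 := card_newWalks_le t R y
    rw [hA, hy.known] at h1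
    have h2 : (Streaming.absorb t R y).kept.card ≤ x.kept.card + (newWalks t R y).card := by
      simp only [Streaming.absorb, hy.kept]
      exact Finset.card_union_le _ _
    have := h.kept_card
    omega

/-- Suppose `w` is missing and isolate it in the known set enlarged by `w`. The isolating `S` then
contains fewer than `r` known centers, so the table of `c` was not full in the detection from `S`,
and `w` was found there. -/
theorem SweepInv.known_complete {G : SimpleGraph (Fin n)} {t r R : ℕ} {A : Finset (Fin n)}
    {E : Finset (Fin n × Fin n)} {F : List (Finset (Fin n))} {x : State n}
    (h : SweepInv G t r R A E F x) (hF : Selective t r F) {c : Fin n} (hc : c ∈ A)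
    (hct : (x.known c).card < t) {w : Fin n} (hw : w ∈ A) (hn : Near G c w R) :
    w ∈ x.known c := by
  by_contra hwc
  obtain ⟨S, hS, hwS, hcard⟩ := hF (insert w (x.known c))
    ((Finset.card_insert_le _ _).trans hct) w (Finset.mem_insert_self _ _)
  rcases h.complete S hS c hc hct w (Finset.mem_inter.2 ⟨hw, hwS⟩) hn with h1 | h1
  · exact hwc h1
  · rw [Finset.inter_insert_of_mem hwS, Finset.card_insert_of_notMem (by simp [hwc])] at hcard
    omega

theorem achieves_sweep {G : SimpleGraph (Fin n)} {s : List (Sym2 (Fin n))}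
    (hs : IsEdgeStream G s) {t r R B : ℕ} (hr : 1 ≤ r) (hR : 1 ≤ R) {A : Finset (Fin n)}
    {E : Finset (Fin n × Fin n)} (hB : E.card + A.card * (t + r) * R ≤ B)
    (F : List (Finset (Fin n))) {x : State n} (hx : SweepInv G t r R A E [] x) :
    Achieves (memoryBound n r B) s (sweep t r R F) x (SweepInv G t r R A E F) := by
  induction F using List.reverseRecOn with
  | nil => exact ⟨(hx.fits hR hB).cost_le, hx⟩
  | append_singleton F S ih =>
    rw [sweep, List.flatMap_append]
    refine Achieves.append ih fun y hy => ?_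
    rw [List.flatMap_singleton]
    refine (achieves_detect hs hr le_rfl R S (hy.fits hR hB)).append fun z hz => ?_
    exact achieves_localPass (hz.fits le_rfl (hy.fits hR hB)).cost_le
      ((hy.absorb hz).fits hR hB).cost_le (hy.absorb hz)

/-- What one level does: from the state `x` at its beginning to the state `y` at its end. -/
structure LevelSpec (G : SimpleGraph (Fin n)) (t r R : ℕ) (x y : State n) : Prop where
  fits : ∀ B, y.kept.card ≤ B → Fits r B y
  known : y.known = fun _ => ∅
  adj : ∀ p ∈ y.kept, G.Adj p.1 p.2
  sub : x.kept ⊆ y.kept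
  kept_card : y.kept.card ≤ x.kept.card + n + x.centers.card * (t + r) * R
  card : y.centers.card * t ≤ x.centers.card
  forest : ∀ d ≤ R, ∀ v, (∃ a ∈ x.centers, Near G v a d) →
    ∃ a ∈ x.centers, Near (pairGraph y.kept) v a d
  inter : ∀ c ∈ x.centers, (∀ w ∈ x.centers, Near G c w R → Near (pairGraph y.kept) c w R) ∨
    ∃ a ∈ y.centers, Near G c a (2 * R)

/-- The first detection, with cap `1` from all centers, supplies the BFS forest (at most `n` edges);
the sweep then supplies the walks between centers. -/
theorem achieves_level {G : SimpleGraph (Fin n)} {s : List (Sym2 (Fin n))}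
    (hs : IsEdgeStream G s) {t r R B : ℕ} (hr : 1 ≤ r) (hR : 1 ≤ R)
    {F : List (Finset (Fin n))} (hF : Selective t r F) {x : State n} (hx : Fits r B x)
    (hknown : x.known = fun _ => ∅) (hadj : ∀ p ∈ x.kept, G.Adj p.1 p.2)
    (hB : x.kept.card + n + x.centers.card * (t + r) * R ≤ B) :
    Achieves (memoryBound n r B) s (levelProgram t r R F) x (LevelSpec G t r R x) := by
  refine (achieves_detect hs le_rfl hr R Finset.univ hx).append fun y hy => ?_
  have hinv := hy.inv
  rw [Finset.inter_univ] at hinv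
  have hkeep : (keep y).kept.card ≤ x.kept.card + n := by
    have h1 : (keep y).kept.card ≤ y.kept.card + y.found.card := Finset.card_union_le _ _
    have h2 := hinv.card_le
    rw [hy.kept] at h1
    omega
  have hkadj : ∀ p ∈ (keep y).kept, G.Adj p.1 p.2 := by
    intro p hp
    rcases Finset.mem_union.1 hp with hp | hp
    · rw [hy.kept] at hp
      exact hadj p hp
    · exact hinv.adj p hp
  have hk0 : (keep y).known = fun _ => ∅ := hy.known.trans hknown
  have hinit : SweepInv G t r R x.centers (keep y).kept [] (keep y) :=
    ⟨hy.centers, fun a => (hinv.card a).trans hr,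
      fun a => by rw [show (keep y).new = y.old from hy.new]; exact (hinv.card a).trans hr,
      hinv.card_le.trans (Nat.mul_le_mul_left _ hr), subset_rfl, hkadj, by simp [hk0],
      by simp [hk0], by simp, by simp [hk0]⟩
  have hB' : (keep y).kept.card + x.centers.card * (t + r) * R ≤ B := by omega
  refine (achieves_localPass (hy.fits hr hx).cost_le (hinit.fits hR hB').cost_le hinit).append
    fun z hz => ?_
  refine (achieves_sweep hs hr hR hB' F hz).append fun w hw => ?_
  have hwkept : w.kept.card ≤ x.kept.card + n + x.centers.card * (t + r) * R := by
    have h1 := hw.kept_card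
    have h2 := Nat.mul_le_mul_left R hw.sum_known_le
    rw [mul_comm R (x.centers.card * (t + r))] at h2
    omega
  have hfits : ∀ B, w.kept.card ≤ B → Fits r B (advance t w) := fun B hB =>
    ⟨hw.old, hw.new, hw.found, hB, by simp [advance]⟩
  have hKG : pairGraph w.kept ≤ G := pairGraph_le hw.adj
  refine achieves_localPass (hw.fits hR hB').cost_le (hfits B (hwkept.trans hB)).cost_le
    ⟨hfits, rfl, hw.adj, ?_, hwkept, ?_, ?_, ?_⟩
  · refine subset_trans ?_ hw.sub
    rw [← hy.kept]
    exact Finset.subset_union_left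
  · rw [← hw.centers]
    refine card_nextCenters_mul_le fun c v hv => ?_
    rw [hw.centers]
    exact (hw.known_sub c v hv).2.1
  · intro d hd v hv
    obtain ⟨a, ha, h⟩ := hinv.nearest d hd v hv
    exact ⟨a, ha, h.map_le (pairGraph_mono (Finset.subset_union_right.trans hw.sub))⟩
  · intro c hc
    by_cases hct : (w.known c).card < t
    · exact .inl fun v hv hn => (hw.known_sub c v (hw.known_complete hF hc hct hv hn)).2.2
    · refine .inr (exists_nextCenters_near (fun c v hv => ?_) (by rw [hw.centers]; exact hc)
        (not_lt.1 hct))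
      exact (hw.known_sub c v hv).2.2.map_le hKG

end

section

/-! ### All levels -/

variable {n : ℕ}

/-- The program for the first levels. -/
def hierarchyProgram (t : ℕ → ℕ) (r : ℕ) (R : ℕ → ℕ) (F : ℕ → List (Finset (Fin n))) :
    ℕ → List (Pass n (State n))
  | 0 => []
  | i + 1 => hierarchyProgram t r R F i ++ levelProgram (t i) r (R i) (F i)

theorem length_hierarchyProgram_le (t : ℕ → ℕ) (r : ℕ) (R : ℕ → ℕ)
    (F : ℕ → List (Finset (Fin n))) (ℓ : ℕ) : (hierarchyProgram t r R F ℓ).length ≤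
      ∑ i ∈ Finset.range ℓ, ((F i).length + 1) * (R i + 3) := by
  induction ℓ with
  | zero => simp [hierarchyProgram]
  | succ i ih =>
    rw [hierarchyProgram, List.length_append, Finset.sum_range_succ]
    exact add_le_add ih (length_levelProgram _ _ _ _)

/-- At the beginning every vertex is a center and nothing is stored. -/
def startState (n : ℕ) : State n := ⟨Finset.univ, ∅, ∅, fun _ => ∅, fun _ => ∅, fun _ => ∅⟩

/-- A bound for the number of edges stored in the first levels. -/
def keptBound (n : ℕ) (t : ℕ → ℕ) (r : ℕ) (R : ℕ → ℕ) (ℓ : ℕ) : ℕ :=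
  ∑ i ∈ Finset.range ℓ, (n + n / (∏ j ∈ Finset.range i, t j) * (t i + r) * R i)

/-- The state after the first levels. -/
def levelState (s : List (Sym2 (Fin n))) (t : ℕ → ℕ) (r : ℕ) (R : ℕ → ℕ)
    (F : ℕ → List (Finset (Fin n))) (i : ℕ) : State n :=
  runProgram s (hierarchyProgram t r R F i) (startState n)

theorem levelState_succ (s : List (Sym2 (Fin n))) (t : ℕ → ℕ) (r : ℕ) (R : ℕ → ℕ)
    (F : ℕ → List (Finset (Fin n))) (i : ℕ) : levelState s t r R F (i + 1) =
      runProgram s (levelProgram (t i) r (R i) (F i)) (levelState s t r R F i) := by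
  rw [levelState, hierarchyProgram, runProgram_append, levelState]

/-- What holds after the first levels. -/
structure HierarchyInv (G : SimpleGraph (Fin n)) (s : List (Sym2 (Fin n))) (t : ℕ → ℕ) (r : ℕ)
    (R : ℕ → ℕ) (F : ℕ → List (Finset (Fin n))) (B i : ℕ) : Prop where
  bounded : BoundedBy State.cost (memoryBound n r B) s (hierarchyProgram t r R F i) (startState n)
  fits : Fits r B (levelState s t r R F i)
  known : (levelState s t r R F i).known = fun _ => ∅
  adj : ∀ p ∈ (levelState s t r R F i).kept, G.Adj p.1 p.2
  kept_card : (levelState s t r R F i).kept.card ≤ keptBound n t r R i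
  card : (levelState s t r R F i).centers.card * ∏ j ∈ Finset.range i, t j ≤ n

theorem HierarchyInv.achieves {G : SimpleGraph (Fin n)} {s : List (Sym2 (Fin n))}
    (hs : IsEdgeStream G s) {t : ℕ → ℕ} {r : ℕ} {R : ℕ → ℕ} {F : ℕ → List (Finset (Fin n))}
    {B i : ℕ} (ht : ∀ i, 1 ≤ t i) (hr : 1 ≤ r) (hR : ∀ i, 1 ≤ R i)
    (hF : Selective (t i) r (F i)) (hB : keptBound n t r R (i + 1) ≤ B)
    (h : HierarchyInv G s t r R F B i) :
    Achieves (memoryBound n r B) s (levelProgram (t i) r (R i) (F i)) (levelState s t r R F i)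
      (LevelSpec G (t i) r (R i) (levelState s t r R F i)) ∧
    (levelState s t r R F i).kept.card + n +
      (levelState s t r R F i).centers.card * (t i + r) * R i ≤ keptBound n t r R (i + 1) := by
  have hpos : 0 < ∏ j ∈ Finset.range i, t j := Finset.prod_pos fun j _ => ht j
  have h1 : (levelState s t r R F i).centers.card ≤ n / ∏ j ∈ Finset.range i, t j :=
    (Nat.le_div_iff_mul_le hpos).2 h.card
  have h2 : (levelState s t r R F i).kept.card + n +
      (levelState s t r R F i).centers.card * (t i + r) * R i ≤ keptBound n t r R (i + 1) := by
    rw [keptBound, Finset.sum_range_succ, add_assoc]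
    refine add_le_add h.kept_card (Nat.add_le_add_left ?_ n)
    gcongr
  exact ⟨achieves_level hs hr (hR i) hF h.fits h.known h.adj (h2.trans hB), h2⟩

theorem keptBound_mono (n : ℕ) (t : ℕ → ℕ) (r : ℕ) (R : ℕ → ℕ) : Monotone (keptBound n t r R) :=
  monotone_nat_of_le_succ fun i => by
    rw [keptBound, keptBound, Finset.sum_range_succ]
    exact Nat.le_add_right _ _

theorem hierarchyInv {G : SimpleGraph (Fin n)} {s : List (Sym2 (Fin n))}
    (hs : IsEdgeStream G s) {t : ℕ → ℕ} {r : ℕ} {R : ℕ → ℕ} {F : ℕ → List (Finset (Fin n))}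
    {B ℓ : ℕ} (ht : ∀ i, 1 ≤ t i) (hr : 1 ≤ r) (hR : ∀ i, 1 ≤ R i)
    (hF : ∀ i < ℓ, Selective (t i) r (F i)) (hB : keptBound n t r R ℓ ≤ B) :
    ∀ i ≤ ℓ, HierarchyInv G s t r R F B i := by
  intro i
  induction i with
  | zero =>
    intro _
    have hfits : Fits r B (startState n) := by
      constructor <;> simp [startState]
    exact ⟨hfits.cost_le, hfits, rfl, by simp [levelState, hierarchyProgram, runProgram, startState],
      by simp [levelState, hierarchyProgram, runProgram, startState],
      by simp [levelState, hierarchyProgram, runProgram, startState]⟩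
  | succ i ih =>
    intro hi
    have hinv := ih (by omega)
    have hBi := (keptBound_mono n t r R hi).trans hB
    obtain ⟨⟨hb, hl⟩, hk⟩ := hinv.achieves hs ht hr hR (hF i hi) hBi
    rw [← levelState_succ] at hl
    have hk' := hl.kept_card.trans hk
    refine ⟨hinv.bounded.append hb, hl.fits B (hk'.trans hBi), hl.known, hl.adj, hk', ?_⟩
    rw [Finset.prod_range_succ, mul_comm _ (t i), ← mul_assoc]
    exact (Nat.mul_le_mul_right _ hl.card).trans hinv.card

/-- The algorithm built from a hierarchy of levels. -/
theorem exists_algorithm_of_hierarchy {ε : ℝ} (hε : 0 < ε) {ℓ : ℕ} {t r' L R : ℕ → ℕ} {r : ℕ}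
    {F : ℕ → List (Finset (Fin n))} (hr : ∀ i, r' (i + 1) = r' i + 2 * R i)
    (hR : ∀ i, R i = 2 * (L i + r' i)) (hL : ∀ i, 1 ≤ L i)
    (hLr : ∀ i, (4 * r' i : ℝ) ≤ (1 + ε) * L i) (ht : ∀ i, 1 ≤ t i) (hr1 : 1 ≤ r)
    (hF : ∀ i < ℓ, Selective (t i) r (F i)) (hn : n < ∏ i ∈ Finset.range ℓ, t i)
    {ctr : ℕ → List (Fin n)} (hctr : Function.Injective ctr) {P j : ℕ}
    (hP : ∑ i ∈ Finset.range ℓ, ((F i).length + 1) * (R i + 3) ≤ P)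
    (hj : ∀ t ≤ P, (ctr t).length ≤ j) :
    ∃ A : Algorithm n, ∀ (G : SimpleGraph (Fin n)) (s : List (Sym2 (Fin n))), IsEdgeStream G s →
      A.ComputesAPSP G s (4 + ε) (r' ℓ) ∧
      A.SurelyLE s Config.peak ((memoryBound n r (keptBound n t r R ℓ) + j + 1 : ℕ) : ℝ) ∧
      A.SurelyLE s Config.passes (P : ℝ) := by
  have hlen := (length_hierarchyProgram_le t r R F ℓ).trans hP
  refine ⟨programAlgorithm (hierarchyProgram t r R F ℓ) (startState n)
    (fun x => subgraphOutput (pairGraph x.kept)) State.code ctr, fun G s hs => ?_⟩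
  have hR1 : ∀ i, 1 ≤ R i := fun i => by have := hL i; rw [hR]; omega
  have hinv := hierarchyInv hs ht hr1 hR1 hF le_rfl
  have hspec : ∀ i < ℓ, LevelSpec G (t i) r (R i) (levelState s t r R F i)
      (levelState s t r R F (i + 1)) := by
    intro i hi
    rw [levelState_succ]
    exact ((hinv i hi.le).achieves hs ht hr1 hR1 (hF i hi) (keptBound_mono n t r R hi)).1.2
  have hsub : ∀ i ≤ ℓ, (levelState s t r R F i).kept ⊆ (levelState s t r R F ℓ).kept := by
    intro i hi
    induction hi using Nat.decreasingInduction with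
    | self => exact subset_rfl
    | of_succ i hi ih => exact (hspec i hi).sub.trans ih
  have hK : pairGraph (levelState s t r R F ℓ).kept ≤ G := pairGraph_le (hinv ℓ le_rfl).adj
  -- The number of remaining centers times the product of all thresholds is at most `n`, which is
  -- less than this product.
  have hempty : (levelState s t r R F ℓ).centers = ∅ := by
    rw [← Finset.card_eq_zero]
    have := (hinv ℓ le_rfl).card
    by_contra hne
    have := Nat.le_mul_of_pos_left (∏ i ∈ Finset.range ℓ, t i) (Nat.pos_of_ne_zero hne)
    omega
  have hout : IsApproxAPSP G (4 + ε) (r' ℓ)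
      (subgraphOutput (pairGraph (levelState s t r R F ℓ).kept)) := by
    refine isApproxAPSP_subgraphOutput hK fun u v p => ?_
    refine exists_walk_of_hierarchy hK hε (A := fun i => ↑(levelState s t r R F i).centers)
      ?_ ?_ hr hR hL hLr ?_ ?_ p
    · simp [levelState, hierarchyProgram, runProgram, startState]
    · simp [hempty]
    · intro i hi d hd y hy
      obtain ⟨a, ha, h⟩ := (hspec i hi).forest d hd y hy
      exact ⟨a, ha, h.map_le (pairGraph_mono (hsub (i + 1) hi))⟩
    · intro i hi c hc
      refine ((hspec i hi).inter c hc).imp (fun h w hw hn => ?_) id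
      exact (h w hw hn).map_le (pairGraph_mono (hsub (i + 1) hi))
  obtain ⟨h1, h2, h3⟩ := programAlgorithm_computes (out := fun x => subgraphOutput (pairGraph x.kept))
    (memoryOf_injective State.code_injective hctr) (hinv ℓ le_rfl).bounded
    (fun t ht => hj t (ht.trans hlen)) hout
  exact ⟨h1, h2, h3.mono (by exact_mod_cast hlen)⟩

end

section

/-! ### A spanning forest in one pass -/

variable {n : ℕ}

/-- A label for each vertex, and the edges of a forest whose components are the sets of vertices
with the same label. -/
abbrev ForestState (n : ℕ) : Type := (Fin n → Fin n) × Finset (Fin n × Fin n)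

/-- Add an edge to the forest if it joins two components. -/
def forestStep (x : ForestState n) (e : Sym2 (Fin n)) : ForestState n :=
  if x.1 (Quot.out e).1 = x.1 (Quot.out e).2 then x
  else (fun v => if x.1 v = x.1 (Quot.out e).2 then x.1 (Quot.out e).1 else x.1 v,
    insert (Quot.out e) x.2)

/-- What holds after the edges in `l` have been read. -/
structure ForestInv (G : SimpleGraph (Fin n)) (l : List (Sym2 (Fin n))) (x : ForestState n) :
    Prop where
  adj : ∀ p ∈ x.2, G.Adj p.1 p.2
  reach : ∀ u v, x.1 u = x.1 v → (pairGraph x.2).Reachable u v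
  label : ∀ u v, s(u, v) ∈ l → x.1 u = x.1 v
  card : x.2.card + (Finset.univ.image x.1).card ≤ n

/-- Every stored edge merges two label classes, so edges plus classes never exceed `n`. -/
theorem ForestInv.step {G : SimpleGraph (Fin n)} {l : List (Sym2 (Fin n))} {x : ForestState n}
    (h : ForestInv G l x) {e : Sym2 (Fin n)} (he : e ∈ G.edgeSet) :
    ForestInv G (l ++ [e]) (forestStep x e) := by
  have hout : s((Quot.out e).1, (Quot.out e).2) = e := Quot.out_eq e
  have hadj : G.Adj (Quot.out e).1 (Quot.out e).2 := by
    rw [← SimpleGraph.mem_edgeSet, hout]; exact he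
  have hmem : ∀ u v, s(u, v) ∈ l ++ [e] → s(u, v) ∈ l ∨
      (u = (Quot.out e).1 ∧ v = (Quot.out e).2) ∨ (u = (Quot.out e).2 ∧ v = (Quot.out e).1) := by
    intro u v huv
    rcases List.mem_append.1 huv with h1 | h1
    · exact .inl h1
    · rw [List.mem_singleton, ← hout, Sym2.eq_iff] at h1
      exact .inr h1
  unfold forestStep
  generalize Quot.out e = p at *
  obtain ⟨a, b⟩ := p
  split_ifs with hab
  · refine ⟨h.adj, h.reach, fun u v huv => ?_, h.card⟩
    rcases hmem u v huv with h1 | ⟨rfl, rfl⟩ | ⟨rfl, rfl⟩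
    · exact h.label u v h1
    · exact hab
    · exact hab.symm
  · have hle : pairGraph x.2 ≤ pairGraph (insert (a, b) x.2) :=
      pairGraph_mono (Finset.subset_insert _ _)
    have hab' : (pairGraph (insert (a, b) x.2)).Reachable a b :=
      (pairGraph_adj hadj.ne (Finset.mem_insert_self _ _)).reachable
    refine ⟨?_, ?_, ?_, ?_⟩
    · intro p hp
      rcases Finset.mem_insert.1 hp with rfl | hp
      · exact hadj
      · exact h.adj p hp
    · intro u v huv
      dsimp only at huv
      split_ifs at huv with h1 h2 h2
      · exact (h.reach u v (h1.trans h2.symm)).mono hle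
      · exact (((h.reach u b h1).mono hle).trans hab'.symm).trans ((h.reach a v huv).mono hle)
      · exact (((h.reach u a huv).mono hle).trans hab').trans ((h.reach b v h2.symm).mono hle)
      · exact (h.reach u v huv).mono hle
    · intro u v huv
      rcases hmem u v huv with h1 | ⟨rfl, rfl⟩ | ⟨rfl, rfl⟩
      · simp only [h.label u v h1]
      · simp
      · simp
    · have h1 : (insert (a, b) x.2).card ≤ x.2.card + 1 := Finset.card_insert_le _ _
      have h2 : (Finset.univ.image fun v => if x.1 v = x.1 b then x.1 a else x.1 v) ⊆
          (Finset.univ.image x.1).erase (x.1 b) := by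
        intro c hc
        obtain ⟨v, -, rfl⟩ := Finset.mem_image.1 hc
        split_ifs with hv
        · exact Finset.mem_erase.2 ⟨hab, Finset.mem_image_of_mem _ (Finset.mem_univ _)⟩
        · exact Finset.mem_erase.2 ⟨hv, Finset.mem_image_of_mem _ (Finset.mem_univ _)⟩
      have h3 := Finset.card_le_card h2
      have h4 : x.1 b ∈ Finset.univ.image x.1 := Finset.mem_image_of_mem _ (Finset.mem_univ _)
      rw [Finset.card_erase_of_mem h4] at h3
      have h5 := Finset.card_pos.2 ⟨_, h4⟩
      have := h.card
      dsimp only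
      omega

theorem ForestInv.foldl {G : SimpleGraph (Fin n)} (l : List (Sym2 (Fin n)))
    (hl : ∀ e ∈ l, e ∈ G.edgeSet) : ForestInv G l (l.foldl forestStep (id, ∅)) := by
  induction l using List.reverseRecOn with
  | nil =>
    exact ⟨by simp, fun u v h => by rw [show u = v from h], by simp, by simp⟩
  | append_singleton l e ih =>
    rw [List.foldl_append]
    exact (ih fun e he => hl e (by simp [he])).step (hl e (by simp))

/-- The lists that represent a forest state. -/
def forestCode (x : ForestState n) : List (List (Fin n)) :=
  [List.ofFn x.1, x.2.toList.map Prod.fst, x.2.toList.map Prod.snd]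

theorem forestCode_injective : Function.Injective (forestCode (n := n)) := by
  intro x y h
  simp only [forestCode, List.cons.injEq, and_true] at h
  exact Prod.ext (List.ofFn_injective h.1) (finset_toList_inj (list_eq_of_map_fst_snd h.2.1 h.2.2))

/-- A path has fewer than `n` edges, so any walk in a spanning forest, shortened to a path, is
within additive error `n`. -/
theorem exists_spanningForest_algorithm (hn : 1 ≤ n) {α : ℝ} (hα : 0 ≤ α) :
    ∃ A : Algorithm n, ∀ (G : SimpleGraph (Fin n)) (s : List (Sym2 (Fin n))), IsEdgeStream G s →
      A.ComputesAPSP G s α n ∧ A.SurelyLE s Config.peak (8 * n) ∧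
      A.SurelyLE s Config.passes 1 := by
  let prog : List (Pass n (ForestState n)) := [⟨forestStep, id⟩]
  -- A unary counter suffices for a single pass and also exists for `n = 1`, where there are no base
  -- `n` digits.
  let ctr : ℕ → List (Fin n) := fun k => List.replicate k ⟨0, hn⟩
  have hctr : Function.Injective ctr := List.replicate_left_injective _
  refine ⟨programAlgorithm prog (id, ∅) (fun x => subgraphOutput (pairGraph x.2)) forestCode ctr,
    fun G s hs => ?_⟩
  have hinv : ∀ l, l <+: s → ForestInv G l (l.foldl forestStep (id, ∅)) := fun l hl =>
    ForestInv.foldl l fun e he => (hs.2 e).1 (hl.subset he)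
  have hcost : ∀ l, l <+: s → listsCost (forestCode (l.foldl forestStep (id, ∅))) ≤
      3 * n + 3 := by
    intro l hl
    have := (hinv l hl).card
    simp [forestCode, listsCost]
    omega
  have hs' := hinv s List.prefix_rfl
  have hb : BoundedBy (fun x => listsCost (forestCode x)) (3 * n + 3) s prog (id, ∅) :=
    ⟨hcost, hcost s List.prefix_rfl⟩
  have hout : IsApproxAPSP G α n
      (subgraphOutput (pairGraph (runProgram s prog (id, ∅)).2)) := by
    refine isApproxAPSP_subgraphOutput (pairGraph_le hs'.adj) fun u v p => ?_
    have hlab : (s.foldl forestStep (id, ∅)).1 u = (s.foldl forestStep (id, ∅)).1 v := by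
      induction p with
      | nil => rfl
      | cons h q ih => exact (hs'.label _ _ ((hs.2 _).2 h)).trans ih
    obtain ⟨q, hq⟩ := (hs'.reach u v hlab).exists_isPath
    have hlen := hq.length_lt
    rw [Fintype.card_fin] at hlen
    refine ⟨q, ?_⟩
    have h1 : (q.length : ℝ) ≤ n := by exact_mod_cast hlen.le
    have h2 : 0 ≤ α * p.length := by positivity
    linarith
  obtain ⟨h1, h2, h3⟩ := programAlgorithm_computes
    (out := fun x : ForestState n => subgraphOutput (pairGraph x.2))
    (memoryOf_injective forestCode_injective hctr) hb (j := 1)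
    (fun t ht => by simpa [ctr, prog] using ht) hout
  refine ⟨h1, h2.mono ?_, by simpa [prog] using h3⟩
  have : (1 : ℝ) ≤ n := by exact_mod_cast hn
  push_cast
  linarith

/-! ### Selective families -/

theorem selective_univ {t r : ℕ} (h : t ≤ r) : Selective t r [(Finset.univ : Finset (Fin n))] :=
  fun T hT w _ => ⟨Finset.univ, by simp, Finset.mem_univ _, by simpa using hT.trans h⟩

open Polynomial in
/-- The sets of polynomials of low degree with a given value at a given point isolate the elements
of small sets. -/
theorem exists_selective {q t d : ℕ} (hq : q.Prime) (hqt : t * d < q) (hqd : n ≤ q ^ d) :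
    ∃ F : List (Finset (Fin n)), F.length = q ^ 2 ∧ Selective t 1 F := by
  classical
  have : Fact q.Prime := ⟨hq⟩
  obtain ⟨f, hf⟩ : ∃ f : Fin n → degreeLT (ZMod q) d, Function.Injective f := by
    let e := degreeLTEquiv (ZMod q) d
    have hcard : Fintype.card (Fin n) ≤ Fintype.card (Fin d → ZMod q) := by
      simpa [ZMod.card] using hqd
    obtain ⟨g⟩ := Function.Embedding.nonempty_of_card_le hcard
    exact ⟨fun x => e.symm (g x), e.symm.injective.comp g.injective⟩
  let S : ZMod q × ZMod q → Finset (Fin n) :=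
    fun p => Finset.univ.filter fun x => (f x : (ZMod q)[X]).eval p.1 = p.2
  refine ⟨(Finset.univ : Finset (ZMod q × ZMod q)).toList.map S, ?_, ?_⟩
  · simp [ZMod.card, sq]
  · intro T hT w hw
    -- Points at which some other element of `T` agrees with `w`: at most `d` for each by counting
    -- roots, fewer than `q` in all since `t * d < q`.
    let bad : Finset (ZMod q) :=
      (T.erase w).biUnion fun x => ((f x : (ZMod q)[X]) - f w).roots.toFinset
    have hbad : bad.card < Fintype.card (ZMod q) := by
      rw [ZMod.card]
      refine lt_of_le_of_lt ?_ hqt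
      refine (Finset.card_biUnion_le_card_mul _ _ d fun x hx => ?_).trans
        (Nat.mul_le_mul_right _ ((Finset.card_le_card (Finset.erase_subset _ _)).trans hT))
      refine (Multiset.toFinset_card_le _).trans ?_
      have hne : (f x : (ZMod q)[X]) - f w ≠ 0 := fun h0 =>
        (Finset.mem_erase.1 hx).1 (hf (Subtype.ext (sub_eq_zero.1 h0)))
      have hdeg : ((f x : (ZMod q)[X]) - f w).degree < d :=
        mem_degreeLT.1 ((degreeLT (ZMod q) d).sub_mem (f x).2 (f w).2)
      refine (card_roots' _).trans ?_
      exact ((natDegree_lt_iff_degree_lt hne).2 hdeg).le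
    obtain ⟨a, ha⟩ : ∃ a, a ∉ bad := by
      by_contra! hcon
      exact hbad.ne (by rw [Finset.eq_univ_iff_forall.2 hcon, Finset.card_univ])
    refine ⟨S (a, (f w : (ZMod q)[X]).eval a), List.mem_map_of_mem (by simp), by simp [S], ?_⟩
    rw [Finset.card_le_one]
    have key : ∀ x ∈ S (a, (f w : (ZMod q)[X]).eval a) ∩ T, x = w := by
      intro x hx
      by_contra hne
      simp only [S, Finset.mem_inter, Finset.mem_filter, Finset.mem_univ, true_and] at hx
      refine ha (Finset.mem_biUnion.2 ⟨x, Finset.mem_erase.2 ⟨hne, hx.2⟩, ?_⟩)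
      rw [Multiset.mem_toFinset, mem_roots', IsRoot.def, eval_sub, hx.1, sub_self]
      exact ⟨fun h0 => hne (hf (Subtype.ext (sub_eq_zero.1 h0))), rfl⟩
    intro x hx y hy
    rw [key x hx, key y hy]

end

section

/-! ### The choice of parameters -/

/-- The jump length that belongs to a radius. -/
def jumpLength (ε : ℝ) (r : ℕ) : ℕ := ⌊4 * (r : ℝ) / (1 + ε)⌋₊ + 1

/-- The radius of the clusters of a level. -/
def radius (ε : ℝ) : ℕ → ℕ
  | 0 => 0
  | i + 1 => radius ε i + 2 * (2 * (jumpLength ε (radius ε i) + radius ε i))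

/-- The depth of the detections of a level. -/
def depth (ε : ℝ) (i : ℕ) : ℕ := 2 * (jumpLength ε (radius ε i) + radius ε i)

/-- The growth rate of the radii. -/
def growthRate (ε : ℝ) : ℝ := 5 + 16 / (1 + ε)

theorem five_le_growthRate {ε : ℝ} (hε : 0 < ε) : 5 ≤ growthRate ε := by
  have : 0 ≤ 16 / (1 + ε) := by positivity
  rw [growthRate]; linarith

theorem growthRate_le {ε : ℝ} (hε : 0 < ε) : growthRate ε ≤ 21 := by
  have : 16 / (1 + ε) ≤ 16 := div_le_self (by norm_num) (by linarith)
  rw [growthRate]; linarith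

theorem growthRate_le_base {ε : ℝ} (hε : 0 < ε) : growthRate ε ≤ 5 + 16 / ε := by
  rw [growthRate]
  gcongr
  linarith

theorem le_jumpLength {ε : ℝ} (hε : 0 < ε) (r : ℕ) : (4 * r : ℝ) ≤ (1 + ε) * jumpLength ε r := by
  have h := (Nat.lt_floor_add_one (4 * (r : ℝ) / (1 + ε))).le
  rw [div_le_iff₀ (by linarith)] at h
  rw [jumpLength]
  push_cast
  linarith

/-- The recursion is `5 * r + 4 * L` with `L ≤ 4 * r / (1 + ε) + 1`. The summand `1` absorbs the
remaining constant because the rate is at least `5`. -/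
theorem radius_add_one_le {ε : ℝ} (hε : 0 < ε) (i : ℕ) : (radius ε i : ℝ) + 1 ≤ growthRate ε ^ i := by
  induction i with
  | zero => simp [radius]
  | succ i ih =>
    have h1 : (jumpLength ε (radius ε i) : ℝ) ≤ 4 * (radius ε i : ℝ) / (1 + ε) + 1 := by
      rw [jumpLength]
      push_cast
      gcongr
      exact Nat.floor_le (by positivity)
    have h5 := five_le_growthRate hε
    have h2 : (radius ε (i + 1) : ℝ) ≤ growthRate ε * radius ε i + 4 := by
      have : growthRate ε * radius ε i = 5 * radius ε i + 4 * (4 * (radius ε i : ℝ) / (1 + ε)) := by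
        rw [growthRate]; ring
      rw [radius]
      push_cast
      linarith
    calc (radius ε (i + 1) : ℝ) + 1 ≤ growthRate ε * (radius ε i + 1) := by linarith
      _ ≤ growthRate ε * growthRate ε ^ i := by gcongr
      _ = growthRate ε ^ (i + 1) := by ring

theorem two_mul_depth_le {ε : ℝ} (hε : 0 < ε) (i : ℕ) :
    2 * (depth ε i : ℝ) ≤ growthRate ε ^ (i + 1) := by
  have h1 := radius_add_one_le hε (i + 1)
  have h2 : radius ε (i + 1) = radius ε i + 2 * depth ε i := rfl
  rw [h2] at h1
  push_cast at h1
  have : (0 : ℝ) ≤ radius ε i := Nat.cast_nonneg _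
  linarith

theorem sum_growthRate_le {ε : ℝ} (hε : 0 < ε) (ℓ : ℕ) :
    ∑ i ∈ Finset.range ℓ, growthRate ε ^ (i + 1) ≤ 2 * growthRate ε ^ ℓ := by
  have h5 := five_le_growthRate hε
  induction ℓ with
  | zero => simp
  | succ ℓ ih =>
    rw [Finset.sum_range_succ]
    have : 0 ≤ growthRate ε ^ ℓ := by positivity
    have h1 : growthRate ε ^ (ℓ + 1) = growthRate ε * growthRate ε ^ ℓ := by ring
    nlinarith

theorem sum_passes_le {ε : ℝ} (hε : 0 < ε) {ℓ N : ℕ} {f : ℕ → ℕ} (hf : ∀ i < ℓ, f i ≤ N) :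
    ((∑ i ∈ Finset.range ℓ, (f i + 1) * (depth ε i + 3) : ℕ) : ℝ) ≤
      (N + 1) * (4 * growthRate ε ^ ℓ) := by
  have h5 := five_le_growthRate hε
  calc ((∑ i ∈ Finset.range ℓ, (f i + 1) * (depth ε i + 3) : ℕ) : ℝ)
      = ∑ i ∈ Finset.range ℓ, ((f i : ℝ) + 1) * (depth ε i + 3) := by push_cast; rfl
    _ ≤ ∑ i ∈ Finset.range ℓ, ((N : ℝ) + 1) * (2 * growthRate ε ^ (i + 1)) := by
        refine Finset.sum_le_sum fun i hi => ?_
        have h1 : (f i : ℝ) ≤ N := by exact_mod_cast hf i (Finset.mem_range.1 hi)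
        have h2 := two_mul_depth_le hε i
        have h3 : (2 : ℝ) ≤ depth ε i := by
          have : 2 ≤ depth ε i := by unfold depth jumpLength; omega
          exact_mod_cast this
        gcongr
        linarith
    _ = ((N : ℝ) + 1) * (2 * ∑ i ∈ Finset.range ℓ, growthRate ε ^ (i + 1)) := by
        rw [← Finset.mul_sum, ← Finset.mul_sum]
    _ ≤ (N + 1) * (4 * growthRate ε ^ ℓ) := by
        have := sum_growthRate_le hε ℓ
        exact mul_le_mul_of_nonneg_left (by linarith) (by positivity)

/-- The thresholds for the number of close centers, with given exponents. -/
def threshold (n : ℕ) (e : ℕ → ℝ) (i : ℕ) : ℕ := ⌈42 * (n : ℝ) ^ e i⌉₊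

section

variable {n : ℕ} {e : ℕ → ℝ}

theorem le_threshold (i : ℕ) : 42 * (n : ℝ) ^ e i ≤ threshold n e i := Nat.le_ceil _

theorem threshold_le (hn : 1 ≤ n) (he : ∀ i, 0 ≤ e i) (i : ℕ) :
    (threshold n e i : ℝ) ≤ 84 * (n : ℝ) ^ e i := by
  have h1 : (1 : ℝ) ≤ (n : ℝ) ^ e i := Real.one_le_rpow (by exact_mod_cast hn) (he i)
  have h2 := (Nat.ceil_lt_add_one (show 0 ≤ 42 * (n : ℝ) ^ e i by positivity)).le
  rw [threshold]
  linarith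

theorem one_le_threshold (hn : 1 ≤ n) (i : ℕ) : 1 ≤ threshold n e i := by
  have : (0 : ℝ) < n := by exact_mod_cast hn
  exact Nat.ceil_pos.2 (by positivity)

/-- The powers of `n` already multiply to `n`; the factors `42` make the inequality strict. -/
theorem lt_prod_threshold (hn : 1 ≤ n) {ℓ : ℕ} (hsum : 1 ≤ ∑ i ∈ Finset.range ℓ, e i) :
    n < ∏ i ∈ Finset.range ℓ, threshold n e i := by
  have hn' : (1 : ℝ) ≤ n := by exact_mod_cast hn
  have hℓ : ℓ ≠ 0 := by
    rintro rfl
    norm_num at hsum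
  have h1 : (42 : ℝ) ≤ 42 ^ ℓ := le_self_pow₀ (by norm_num) hℓ
  have h2 : (n : ℝ) ≤ (n : ℝ) ^ ∑ i ∈ Finset.range ℓ, e i := by
    simpa using Real.rpow_le_rpow_of_exponent_le hn' hsum
  have h3 : (42 : ℝ) ^ ℓ * (n : ℝ) ^ ∑ i ∈ Finset.range ℓ, e i ≤
      ∏ i ∈ Finset.range ℓ, (threshold n e i : ℝ) := by
    calc (42 : ℝ) ^ ℓ * (n : ℝ) ^ ∑ i ∈ Finset.range ℓ, e i
        = ∏ i ∈ Finset.range ℓ, 42 * (n : ℝ) ^ e i := by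
          rw [Finset.prod_mul_distrib, Real.rpow_sum_of_pos (by linarith)]
          simp
      _ ≤ _ := Finset.prod_le_prod (fun i _ => by positivity) fun i _ => le_threshold i
  have h4 : (n : ℝ) < ∏ i ∈ Finset.range ℓ, (threshold n e i : ℝ) := by nlinarith
  exact_mod_cast h4

/-- From one level to the next the quotient is at most `n ^ (e (i + 1) - 2 * e i) * 21 / 42 ≤ 1 /
2`. Hence exponents may at most double, and the factor `42` in the thresholds is twice the bound
`21` for the growth of the depths. -/
theorem stored_walks_le (hn : 1 ≤ n) (he2 : ∀ i, e (i + 1) ≤ 2 * e i) (i : ℕ) :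
    42 * (n : ℝ) ^ e i * 21 ^ (i + 1) / ∏ j ∈ Finset.range i, (42 * (n : ℝ) ^ e j) ≤
      882 * (n : ℝ) ^ e 0 * (1 / 2) ^ i := by
  have hn' : (1 : ℝ) ≤ n := by exact_mod_cast hn
  induction i with
  | zero => norm_num; linarith
  | succ i ih =>
    have hpos : 0 < ∏ j ∈ Finset.range i, (42 * (n : ℝ) ^ e j) :=
      Finset.prod_pos fun j _ => by positivity
    have hx : 0 < (n : ℝ) ^ e i := by positivity
    have h1 : (n : ℝ) ^ e (i + 1) ≤ (n : ℝ) ^ e i * (n : ℝ) ^ e i := by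
      rw [← Real.rpow_add (by linarith), ← two_mul]
      exact Real.rpow_le_rpow_of_exponent_le hn' (he2 i)
    rw [Finset.prod_range_succ]
    calc 42 * (n : ℝ) ^ e (i + 1) * 21 ^ (i + 1 + 1) /
          ((∏ j ∈ Finset.range i, (42 * (n : ℝ) ^ e j)) * (42 * (n : ℝ) ^ e i))
        ≤ 42 * ((n : ℝ) ^ e i * (n : ℝ) ^ e i) * 21 ^ (i + 1 + 1) /
          ((∏ j ∈ Finset.range i, (42 * (n : ℝ) ^ e j)) * (42 * (n : ℝ) ^ e i)) := by gcongr
      _ = (42 * (n : ℝ) ^ e i * 21 ^ (i + 1) / ∏ j ∈ Finset.range i, (42 * (n : ℝ) ^ e j)) *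
          (1 / 2) := by
          field_simp
          ring
      _ ≤ 882 * (n : ℝ) ^ e 0 * (1 / 2) ^ i * (1 / 2) := by gcongr
      _ = _ := by ring

/-- The forests contribute `ℓ * n`, and the walks a geometric series dominated by level `0`: `7056 =
2 * 4 * 882`. -/
theorem keptBound_threshold_le (hn : 1 ≤ n) {ε : ℝ} (hε : 0 < ε) (he : ∀ i, 0 ≤ e i)
    (he2 : ∀ i, e (i + 1) ≤ 2 * e i) {r : ℕ} (hr : ∀ i, r ≤ threshold n e i) (ℓ : ℕ) :
    (keptBound n (threshold n e) r (depth ε) ℓ : ℝ) ≤ ℓ * n + 7056 * (n : ℝ) ^ (1 + e 0) := by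
  have hn' : (1 : ℝ) ≤ n := by exact_mod_cast hn
  have hterm : ∀ i, ((n / (∏ j ∈ Finset.range i, threshold n e j) * (threshold n e i + r) *
      depth ε i : ℕ) : ℝ) ≤ 3528 * (n : ℝ) ^ (1 + e 0) * (1 / 2) ^ i := by
    intro i
    have hpos : 0 < ∏ j ∈ Finset.range i, (42 * (n : ℝ) ^ e j) :=
      Finset.prod_pos fun j _ => by positivity
    have h1 : ((n / (∏ j ∈ Finset.range i, threshold n e j) : ℕ) : ℝ) ≤
        n / ∏ j ∈ Finset.range i, (42 * (n : ℝ) ^ e j) := by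
      refine Nat.cast_div_le.trans ?_
      push_cast
      gcongr
      exact le_threshold _
    have h2 : ((threshold n e i + r : ℕ) : ℝ) ≤ 4 * (42 * (n : ℝ) ^ e i) := by
      have h3 := threshold_le hn he i
      have h4 : (r : ℝ) ≤ threshold n e i := by exact_mod_cast hr i
      push_cast
      linarith
    have h3 : (depth ε i : ℝ) ≤ 21 ^ (i + 1) := by
      have h4 := two_mul_depth_le hε i
      have h5 : growthRate ε ^ (i + 1) ≤ 21 ^ (i + 1) := by
        have := five_le_growthRate hε
        gcongr
        exact growthRate_le hε
      have : (0 : ℝ) ≤ depth ε i := Nat.cast_nonneg _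
      linarith
    calc _ = ((n / (∏ j ∈ Finset.range i, threshold n e j) : ℕ) : ℝ) *
          ((threshold n e i + r : ℕ) : ℝ) * depth ε i := by push_cast; rfl
      _ ≤ n / (∏ j ∈ Finset.range i, (42 * (n : ℝ) ^ e j)) * (4 * (42 * (n : ℝ) ^ e i)) *
          21 ^ (i + 1) := by gcongr
      _ = 4 * n * (42 * (n : ℝ) ^ e i * 21 ^ (i + 1) /
          ∏ j ∈ Finset.range i, (42 * (n : ℝ) ^ e j)) := by ring
      _ ≤ 4 * n * (882 * (n : ℝ) ^ e 0 * (1 / 2) ^ i) := by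
          gcongr
          exact stored_walks_le hn he2 i
      _ = _ := by
          rw [Real.rpow_add (by linarith), Real.rpow_one]
          ring
  have hgeom : ∑ i ∈ Finset.range ℓ, (1 / 2 : ℝ) ^ i ≤ 2 := by
    have := (summable_geometric_two).sum_le_tsum (Finset.range ℓ) (fun _ _ => by positivity)
    rwa [tsum_geometric_two] at this
  rw [keptBound]
  push_cast [Finset.sum_add_distrib]
  rw [Finset.sum_const, Finset.card_range, nsmul_eq_mul]
  gcongr
  calc _ ≤ ∑ i ∈ Finset.range ℓ, 3528 * (n : ℝ) ^ (1 + e 0) * (1 / 2) ^ i :=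
        Finset.sum_le_sum fun i _ => by simpa using hterm i
    _ = 3528 * (n : ℝ) ^ (1 + e 0) * ∑ i ∈ Finset.range ℓ, (1 / 2 : ℝ) ^ i := by
        rw [Finset.mul_sum]
    _ ≤ 3528 * (n : ℝ) ^ (1 + e 0) * 2 := by gcongr
    _ = _ := by ring

end

/-- A number in base `n`, as a list of vertices. -/
def digitList {n : ℕ} (hn : 0 < n) (k : ℕ) : List (Fin n) :=
  (Nat.digits n k).map fun d => ⟨d % n, Nat.mod_lt _ hn⟩

theorem digitList_injective {n : ℕ} (hn : 2 ≤ n) :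
    Function.Injective (digitList (n := n) (by omega)) := by
  intro k k' h
  have aux : ∀ k, (digitList (n := n) (by omega) k).map Fin.val = Nat.digits n k := by
    intro k
    rw [digitList, List.map_map]
    conv_rhs => rw [← List.map_id (Nat.digits n k)]
    exact List.map_congr_left fun d hd => Nat.mod_eq_of_lt (Nat.digits_lt_base (by omega) hd)
  rw [← Nat.digits_inj_iff (b := n), ← aux, ← aux, h]

theorem length_digitList_le {n : ℕ} (hn : 2 ≤ n) {k j : ℕ} (hk : k < n ^ j) :
    (digitList (n := n) (by omega) k).length ≤ j := by
  rw [digitList, List.length_map]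
  exact (Nat.digits_length_le_iff (by omega) k).2 hk

/-- The algorithm for thresholds with given exponents. -/
theorem exists_algorithm_of_exponents {n : ℕ} (hn : 2 ≤ n) {ε : ℝ} (hε : 0 < ε) {e : ℕ → ℝ}
    (he : ∀ i, 0 ≤ e i) (he2 : ∀ i, e (i + 1) ≤ 2 * e i) {ℓ : ℕ}
    (hsum : 1 ≤ ∑ i ∈ Finset.range ℓ, e i) {r : ℕ} (hr : 1 ≤ r) (hrt : ∀ i, r ≤ threshold n e i)
    {F : ℕ → List (Finset (Fin n))} {N : ℕ} (hN : ∀ i < ℓ, (F i).length ≤ N)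
    (hF : ∀ i < ℓ, Selective (threshold n e i) r (F i)) {j : ℕ}
    (hj : (N + 1) * (4 * growthRate ε ^ ℓ) < (n : ℝ) ^ j) :
    ∃ A : Algorithm n, ∀ (G : SimpleGraph (Fin n)) (s : List (Sym2 (Fin n))), IsEdgeStream G s →
      A.ComputesAPSP G s (4 + ε) (growthRate ε ^ ℓ) ∧
      A.SurelyLE s Config.peak
        (4 * (n * r) + 3 * (ℓ * n + 7056 * (n : ℝ) ^ (1 + e 0)) + 4 * n + 6 + j) ∧
      A.SurelyLE s Config.passes ((N + 1) * (4 * growthRate ε ^ ℓ)) := by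
  have hP := sum_passes_le (f := fun i => (F i).length) hε hN
  obtain ⟨A, hA⟩ := exists_algorithm_of_hierarchy (t := threshold n e) (r' := radius ε)
    (L := fun i => jumpLength ε (radius ε i)) (R := depth ε) hε (fun i => rfl) (fun i => rfl)
    (fun i => Nat.le_add_left _ _) (fun i => le_jumpLength hε _) (one_le_threshold (by omega)) hr hF
    (lt_prod_threshold (by omega) hsum) (digitList_injective hn) le_rfl (j := j)
    (fun t ht => length_digitList_le hn (by
      have h1 : (t : ℝ) < (n : ℝ) ^ j := lt_of_le_of_lt
        ((Nat.cast_le.2 ht).trans hP) hj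
      exact_mod_cast h1))
  refine ⟨A, fun G s hs => ?_⟩
  obtain ⟨h1, h2, h3⟩ := hA G s hs
  refine ⟨h1.mono ?_, h2.mono ?_, h3.mono hP⟩
  · have := radius_add_one_le hε ℓ
    linarith
  · have := keptBound_threshold_le (by omega) hε he he2 hrt ℓ
    rw [memoryBound]
    push_cast
    linarith

end

section

/-! ### The exponent of the additive error -/

/-- The exponent of `5 + 16 / ε` in `beta ε ρ k`. -/
def betaExponent (ρ : ℝ) (k : ℕ) : ℝ := Real.logb 2 ρ + 2 / ρ + Real.logb 2 k

/-- `k ^ logb 2 b = b ^ logb 2 k`, so all of `beta` is one power of `5 + 16 / ε`, to be compared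
with the number of levels. -/
theorem beta_eq {ε ρ : ℝ} {k : ℕ} (hε : 0 < ε) (hk : 1 ≤ k) :
    beta ε ρ k = (5 + 16 / ε) ^ betaExponent ρ k := by
  have hb : 0 < 5 + 16 / ε := by positivity
  have hk' : (0 : ℝ) < k := by exact_mod_cast hk
  have h : (k : ℝ) ^ Real.logb 2 (5 + 16 / ε) = (5 + 16 / ε) ^ Real.logb 2 (k : ℝ) := by
    rw [Real.rpow_def_of_pos hk', Real.rpow_def_of_pos hb, Real.logb, Real.logb]
    congr 1
    ring
  rw [beta, betaExponent, Real.rpow_add hb _ (Real.logb 2 k), h]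

theorem logb_two_le {x : ℝ} (hx : 0 < x) : Real.logb 2 x ≤ x := by
  have h2 := Real.log_two_gt_d9
  have h2' := Real.log_two_lt_d9
  rw [Real.logb, div_le_iff₀ (by linarith)]
  have h1 := Real.log_le_sub_one_of_pos (show 0 < x / 2 by positivity)
  rw [Real.log_div hx.ne' (by norm_num)] at h1
  nlinarith

theorem one_div_le_betaExponent {ρ : ℝ} {k : ℕ} (hρ : 0 < ρ) (hk : 1 ≤ k) :
    1 / ρ ≤ betaExponent ρ k := by
  have h1 := logb_two_le (show 0 < 1 / ρ by positivity)
  rw [one_div, Real.logb_inv] at h1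
  have h2 : 0 ≤ Real.logb 2 (k : ℝ) := Real.logb_nonneg (by norm_num) (by exact_mod_cast hk)
  rw [betaExponent, show 2 / ρ = ρ⁻¹ + ρ⁻¹ by ring, one_div]
  linarith

section

variable {ε ρ : ℝ} {k : ℕ}

/-- The extra level is paid with the absolute bound `21` of the growth rate, since `5 + 16 / ε`
itself is unbounded. -/
theorem growthRate_pow_le (hε : 0 < ε) (hρ : 0 < ρ) (hk : 1 ≤ k) {ℓ : ℕ}
    (hℓ : (ℓ : ℝ) ≤ betaExponent ρ k + 1) : growthRate ε ^ ℓ ≤ 21 * beta ε ρ k := by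
  have h5 := five_le_growthRate hε
  have hE : 0 ≤ betaExponent ρ k := le_trans (by positivity) (one_div_le_betaExponent hρ hk)
  rw [beta_eq hε hk]
  calc growthRate ε ^ ℓ = growthRate ε ^ (ℓ : ℝ) := (Real.rpow_natCast _ _).symm
    _ ≤ growthRate ε ^ (betaExponent ρ k + 1) :=
        Real.rpow_le_rpow_of_exponent_le (by linarith) hℓ
    _ = growthRate ε * growthRate ε ^ betaExponent ρ k := by
        rw [Real.rpow_add (by linarith), Real.rpow_one, mul_comm]
    _ ≤ 21 * (5 + 16 / ε) ^ betaExponent ρ k := by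
        gcongr
        · exact growthRate_le hε
        · exact growthRate_le_base hε

theorem five_rpow_le_beta (hε : 0 < ε) (hρ : 0 < ρ) (hk : 1 ≤ k) :
    (5 : ℝ) ^ (1 / ρ) ≤ beta ε ρ k := by
  have h16 : 0 ≤ 16 / ε := by positivity
  rw [beta_eq hε hk]
  calc (5 : ℝ) ^ (1 / ρ) ≤ 5 ^ betaExponent ρ k :=
        Real.rpow_le_rpow_of_exponent_le (by norm_num) (one_div_le_betaExponent hρ hk)
    _ ≤ _ := Real.rpow_le_rpow (by norm_num) (by linarith)
        (le_trans (by positivity) (one_div_le_betaExponent hρ hk))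

theorem one_le_beta (hε : 0 < ε) (hρ : 0 < ρ) (hk : 1 ≤ k) : 1 ≤ beta ε ρ k :=
  (Real.one_le_rpow (by norm_num) (by positivity)).trans (five_rpow_le_beta hε hρ hk)

theorem one_div_le_log {n : ℕ} (hε : 0 < ε) (hρ : 0 < ρ) (hk : 1 ≤ k)
    (hn : beta ε ρ k < n) : 1 / ρ ≤ Real.log n := by
  have h1 := (five_rpow_le_beta hε hρ hk).trans hn.le
  have h2 := Real.log_le_log (by positivity) h1
  rw [Real.log_rpow (by norm_num)] at h2
  have h3 : 1 ≤ Real.log 5 := by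
    rw [Real.le_log_iff_exp_le (by norm_num)]
    have := Real.exp_one_lt_d9
    linarith
  have h4 : 0 < 1 / ρ := by positivity
  nlinarith

theorem two_le_of_beta_lt {n : ℕ} (hε : 0 < ε) (hρ : 0 < ρ) (hk : 1 ≤ k)
    (hn : beta ε ρ k < n) : 2 ≤ n := by
  have h := (one_le_beta hε hρ hk).trans_lt hn
  exact_mod_cast h

theorem ceil_one_div_le (hρ : 0 < ρ) (hk : 1 ≤ k) :
    ((⌈1 / ρ⌉₊ : ℕ) : ℝ) ≤ betaExponent ρ k + 1 := by
  have h1 := (Nat.ceil_lt_add_one (show 0 ≤ 1 / ρ by positivity)).le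
  have h2 := one_div_le_betaExponent hρ hk
  linarith

/-- For `k * ρ ≤ 2` there is room for `k` levels. -/
theorem natCast_le_betaExponent_add_one (hρ : 0 < ρ) (hk : 1 ≤ k) (hkρ : k * ρ ≤ 2) :
    (k : ℝ) ≤ betaExponent ρ k + 1 := by
  have hk' : (1 : ℝ) ≤ k := by exact_mod_cast hk
  have hk0 : (0 : ℝ) < k := by linarith
  have hz : 0 < 1 / (k * ρ) := by positivity
  have h1 := logb_two_le hz
  rw [one_div, Real.logb_inv, Real.logb_mul hk0.ne' hρ.ne', ← one_div] at h1
  have h2 : 2 / ρ = 2 * k * (1 / (k * ρ)) := by field_simp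
  -- With `x = 1 / (k * ρ)` the exponent equals `2 * k * x - logb 2 x ≥ (2 * k - 1) * x ≥ k - 1 /
  -- 2`.
  have h3 : 1 / 2 ≤ 1 / (k * ρ) := one_div_le_one_div_of_le (by positivity) hkρ
  rw [betaExponent, h2]
  nlinarith

/-- The number of levels with growing thresholds. -/
def growthLevels (ρ : ℝ) (k : ℕ) : ℕ := ⌈Real.logb 2 (k * ρ / 2)⌉₊

/-- The two ceilings cost at most `2`, and the division by `2` in `growthLevels` gives back `1`. -/
theorem levels_le (hρ : 0 < ρ) (hk : 1 ≤ k) (hkρ : 2 < k * ρ) :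
    ((growthLevels ρ k + ⌈2 / ρ⌉₊ : ℕ) : ℝ) ≤ betaExponent ρ k + 1 := by
  have hk0 : (0 : ℝ) < k := by exact_mod_cast hk
  have h1 : 0 ≤ Real.logb 2 (k * ρ / 2) := Real.logb_nonneg (by norm_num) (by linarith)
  have h2 := (Nat.ceil_lt_add_one h1).le
  have h3 := (Nat.ceil_lt_add_one (show 0 ≤ 2 / ρ by positivity)).le
  have h4 : Real.logb 2 (k * ρ / 2) = Real.logb 2 k + Real.logb 2 ρ - 1 := by
    rw [Real.logb_div (by positivity) (by norm_num), Real.logb_mul hk0.ne' hρ.ne',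
      Real.logb_self_eq_one (by norm_num)]
  rw [growthLevels, betaExponent]
  push_cast
  linarith

/-- Exponents that double until they reach `ρ / 2`. -/
def doublingExponent (ρ : ℝ) (k i : ℕ) : ℝ := min (2 ^ i / k) (ρ / 2)

theorem doublingExponent_nonneg (hρ : 0 < ρ) (i : ℕ) : 0 ≤ doublingExponent ρ k i :=
  le_min (by positivity) (by positivity)

theorem doublingExponent_succ_le (hρ : 0 < ρ) (i : ℕ) :
    doublingExponent ρ k (i + 1) ≤ 2 * doublingExponent ρ k i := by
  rw [doublingExponent, doublingExponent, mul_min_of_nonneg _ _ (by norm_num)]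
  refine min_le_min (le_of_eq (by ring)) (by linarith)

/-- The last `⌈2 / ρ⌉₊` levels have the full exponent `ρ / 2` and suffice alone. -/
theorem one_le_sum_doublingExponent (hρ : 0 < ρ) (hk : 1 ≤ k) :
    1 ≤ ∑ i ∈ Finset.range (growthLevels ρ k + ⌈2 / ρ⌉₊), doublingExponent ρ k i := by
  have hk0 : (0 : ℝ) < k := by exact_mod_cast hk
  have hlate : ∀ j, doublingExponent ρ k (growthLevels ρ k + j) = ρ / 2 := by
    intro j
    refine min_eq_right ?_
    have h1 : Real.logb 2 (k * ρ / 2) ≤ growthLevels ρ k := Nat.le_ceil _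
    rw [Real.logb_le_iff_le_rpow (by norm_num) (by positivity), Real.rpow_natCast] at h1
    have h2 : (2 : ℝ) ^ growthLevels ρ k ≤ 2 ^ (growthLevels ρ k + j) :=
      pow_le_pow_right₀ (by norm_num) (Nat.le_add_right _ _)
    rw [le_div_iff₀ hk0]
    linarith
  rw [Finset.sum_range_add, Finset.sum_congr rfl fun j _ => hlate j, Finset.sum_const,
    Finset.card_range, nsmul_eq_mul]
  have h1 : 0 ≤ ∑ i ∈ Finset.range (growthLevels ρ k), doublingExponent ρ k i :=
    Finset.sum_nonneg fun i _ => doublingExponent_nonneg hρ i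
  have h2 : 2 / ρ ≤ ⌈2 / ρ⌉₊ := Nat.le_ceil _
  rw [div_le_iff₀ hρ] at h2
  linarith

theorem Selective.mono {n t t' r : ℕ} {F : List (Finset (Fin n))} (h : Selective t r F)
    (ht : t' ≤ t) : Selective t' r F :=
  fun T hT w hw => h T (hT.trans ht) w hw

/-- Selective families for the capped exponents. -/
theorem exists_selective_doublingExponent {n : ℕ} (hn : 1 ≤ n) (hρ : 0 < ρ) (hρ1 : ρ < 1) :
    ∃ F : List (Finset (Fin n)), (F.length : ℝ) ≤ 254016 * ((n : ℝ) ^ ρ / ρ ^ 2) ∧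
      ∀ i, Selective (threshold n (doublingExponent ρ k) i) 1 F := by
  have hn' : (1 : ℝ) ≤ n := by exact_mod_cast hn
  set t := ⌈42 * (n : ℝ) ^ (ρ / 2)⌉₊ with ht
  set d := ⌈2 / ρ⌉₊ with hd
  have ht1 : 42 * (n : ℝ) ^ (ρ / 2) ≤ t := Nat.le_ceil _
  have hx : (1 : ℝ) ≤ (n : ℝ) ^ (ρ / 2) := Real.one_le_rpow hn' (by positivity)
  have ht2 : (t : ℝ) ≤ 84 * (n : ℝ) ^ (ρ / 2) := by
    have := (Nat.ceil_lt_add_one (show 0 ≤ 42 * (n : ℝ) ^ (ρ / 2) by positivity)).le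
    linarith
  have hd1 : 2 / ρ ≤ d := Nat.le_ceil _
  have hd2 : (d : ℝ) ≤ 3 / ρ := by
    have h1 := (Nat.ceil_lt_add_one (show 0 ≤ 2 / ρ by positivity)).le
    have h2 : 1 ≤ 1 / ρ := by rw [le_div_iff₀ hρ]; linarith
    have h3 : 3 / ρ = 2 / ρ + 1 / ρ := by ring
    linarith
  have hdpos : 1 ≤ d := Nat.ceil_pos.2 (by positivity)
  have htpos : 1 ≤ t := Nat.ceil_pos.2 (by positivity)
  -- Bertrand's postulate keeps `q` of order `n ^ (ρ / 2) / ρ`, so the `q ^ 2` members number `O(n ^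
  -- ρ / ρ ^ 2)`. As all exponents are at most `ρ / 2`, one family serves every level.
  obtain ⟨q, hq, hq1, hq2⟩ := Nat.exists_prime_lt_and_le_two_mul (t * d)
    (Nat.mul_pos htpos hdpos).ne'
  have hqt : (n : ℝ) ^ (ρ / 2) ≤ q := by
    have h1 : t ≤ q := (Nat.le_mul_of_pos_right t hdpos).trans hq1.le
    have h2 : (t : ℝ) ≤ q := by exact_mod_cast h1
    linarith
  have hqd : n ≤ q ^ d := by
    have h1 : (n : ℝ) ≤ (q : ℝ) ^ d := by
      calc (n : ℝ) = (n : ℝ) ^ (1 : ℝ) := (Real.rpow_one _).symm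
        _ ≤ (n : ℝ) ^ (ρ / 2 * d) := by
            refine Real.rpow_le_rpow_of_exponent_le hn' ?_
            rw [div_le_iff₀ hρ] at hd1
            linarith
        _ = ((n : ℝ) ^ (ρ / 2)) ^ d := by
            rw [Real.rpow_mul (by linarith), Real.rpow_natCast]
        _ ≤ (q : ℝ) ^ d := by gcongr
    exact_mod_cast h1
  obtain ⟨F, hF1, hF2⟩ := exists_selective (n := n) hq hq1 hqd
  refine ⟨F, ?_, fun i => hF2.mono (Nat.ceil_mono ?_)⟩
  · rw [hF1]
    push_cast
    have h1 : (q : ℝ) ≤ 2 * (84 * (n : ℝ) ^ (ρ / 2) * (3 / ρ)) := by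
      calc (q : ℝ) ≤ 2 * (t * d) := by exact_mod_cast hq2
        _ ≤ _ := by gcongr
    calc (q : ℝ) ^ 2 ≤ (2 * (84 * (n : ℝ) ^ (ρ / 2) * (3 / ρ))) ^ 2 := by gcongr
      _ = 254016 * (((n : ℝ) ^ (ρ / 2)) ^ 2 / ρ ^ 2) := by ring
      _ = _ := by
          rw [← Real.rpow_natCast, ← Real.rpow_mul (by linarith)]
          norm_num
  · gcongr
    exact min_le_right _ _

end

end

section

/-! ### The two algorithms -/

theorem probLE_of_nonpos {n : ℕ} (A : Algorithm n) (s : List (Sym2 (Fin n))) (f : Config n → ℕ)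
    (x : ℝ) {p : ℝ} (hp : p ≤ 0) : A.ProbLE s f x p := fun t => by
  rw [ENNReal.ofReal_of_nonpos hp]
  exact zero_le

theorem one_sub_rpow_neg_le_one (n : ℕ) (c : ℝ) : 1 - (n : ℝ) ^ (-c) ≤ 1 := by
  have : 0 ≤ (n : ℝ) ^ (-c) := by positivity
  linarith

/-- If the surplus is at least the number of vertices, then a spanning forest suffices. -/
theorem exists_algorithm_of_le_beta {n k : ℕ} {ε ρ : ℝ} (hn : 1 ≤ n) (hk : 1 ≤ k) (hε : 0 < ε)
    (hρ : 0 < ρ) (hρ1 : ρ < 1) (c : ℝ) (hβ : n ≤ beta ε ρ k) :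
    ∃ A : Algorithm n,
      ∀ (G : SimpleGraph (Fin n)) (s : List (Sym2 (Fin n))), IsEdgeStream G s →
        A.ComputesAPSP G s (4 + ε) (30000 * beta ε ρ k) ∧
        A.ProbLE s Config.peak (100000000 * ((n : ℝ) ^ (1 + ρ) * Real.log n))
          (1 - (n : ℝ) ^ (-c)) ∧
        A.SurelyLE s Config.passes (30000 * beta ε ρ k) ∧
        A.ExpectedLE s Config.peak (30000 * ((n : ℝ) ^ (1 + 1 / (k : ℝ)) +
          (beta ε ρ k + Real.log n) * (n : ℝ))) ∧
        A.ProbLE s Config.passes (100000000 * ((n : ℝ) ^ ρ / ρ * Real.log n * beta ε ρ k))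
          (1 - (n : ℝ) ^ (-c)) := by
  have hn' : (1 : ℝ) ≤ n := by exact_mod_cast hn
  have hβ1 := one_le_beta hε hρ hk
  obtain ⟨A, hA⟩ := exists_spanningForest_algorithm hn (show 0 ≤ 4 + ε by positivity)
  refine ⟨A, fun G s hs => ?_⟩
  obtain ⟨h1, h2, h3⟩ := hA G s hs
  have hlog : 0 ≤ Real.log n := Real.log_nonneg hn'
  refine ⟨h1.mono (by linarith), ?_, h3.mono (by linarith), (h2.mono ?_).expectedLE, ?_⟩
  -- For `n = 1` the bound contains `log 1 = 0`, but the required probability is `1 - 1 = 0`.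
  · rcases hn.eq_or_lt with rfl | hn2
    · exact probLE_of_nonpos _ _ _ _ (by simp)
    · refine (h2.mono ?_).probLE (one_sub_rpow_neg_le_one n c)
      have h4 : (n : ℝ) ≤ (n : ℝ) ^ (1 + ρ) := by
        simpa using Real.rpow_le_rpow_of_exponent_le hn' (show 1 ≤ 1 + ρ by linarith)
      have h5 : Real.log 2 ≤ Real.log n := Real.log_le_log (by norm_num) (by exact_mod_cast hn2)
      have h6 := Real.log_two_gt_d9
      nlinarith
  · have h4 : 0 ≤ (n : ℝ) ^ (1 + 1 / (k : ℝ)) := by positivity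
    nlinarith
  · rcases hn.eq_or_lt with rfl | hn2
    · exact probLE_of_nonpos _ _ _ _ (by simp)
    · refine (h3.mono ?_).probLE (one_sub_rpow_neg_le_one n c)
      have h4 : 1 ≤ (n : ℝ) ^ ρ / ρ := by
        rw [le_div_iff₀ hρ]
        have := Real.one_le_rpow hn' hρ.le
        linarith
      have h5 : Real.log 2 ≤ Real.log n := Real.log_le_log (by norm_num) (by exact_mod_cast hn2)
      have h6 := Real.log_two_gt_d9
      have h7 : 1 / 2 ≤ (n : ℝ) ^ ρ / ρ * Real.log n := by nlinarith
      nlinarith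

/-- Pass counts fit into `30` digits in base `n`: the constant is `2 ^ 25`, less than `n ^ 26`. -/
theorem mul_lt_pow_of_lt {n : ℕ} (hn : 2 ≤ n) {x : ℝ} (hx : x ≤ 33554432 * (n : ℝ) ^ 4) :
    x < (n : ℝ) ^ 30 := by
  have hn' : (2 : ℝ) ≤ n := by exact_mod_cast hn
  have h1 : (2 : ℝ) ^ 26 ≤ (n : ℝ) ^ 26 := by gcongr
  have h2 : (0 : ℝ) < (n : ℝ) ^ 4 := by positivity
  have h3 : (n : ℝ) ^ 30 = (n : ℝ) ^ 26 * (n : ℝ) ^ 4 := by ring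
  rw [h3]
  nlinarith

/-- Detection from all centers at once, with the same threshold on all levels. -/
theorem exists_algorithm_uniform {n k ℓ : ℕ} {ε ρ a : ℝ} (hk : 1 ≤ k) (hε : 0 < ε) (hρ : 0 < ρ)
    (hβ : beta ε ρ k < n) (ha : 0 ≤ a) (hℓa : 1 ≤ ℓ * a) (hℓ : (ℓ : ℝ) ≤ betaExponent ρ k + 1) :
    ∃ A : Algorithm n,
      ∀ (G : SimpleGraph (Fin n)) (s : List (Sym2 (Fin n))), IsEdgeStream G s →
        A.ComputesAPSP G s (4 + ε) (21 * beta ε ρ k) ∧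
        A.SurelyLE s Config.peak (3 * (ℓ * n) + 22000 * (n : ℝ) ^ (1 + a)) ∧
        A.SurelyLE s Config.passes (168 * beta ε ρ k) := by
  have hn := two_le_of_beta_lt hε hρ hk hβ
  have hn' : (2 : ℝ) ≤ n := by exact_mod_cast hn
  have hg := growthRate_pow_le hε hρ hk hℓ
  have ht := threshold_le (n := n) (e := fun _ => a) (by omega) (fun _ => ha) 0
  obtain ⟨A, hA⟩ := exists_algorithm_of_exponents hn hε (e := fun _ => a) (fun _ => ha)
    (fun _ => by linarith) (ℓ := ℓ) (by simpa using hℓa) (r := threshold n (fun _ => a) 0)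
    (one_le_threshold (by omega) 0) (fun _ => le_rfl) (F := fun _ => [Finset.univ]) (N := 1)
    (fun _ _ => by simp) (fun _ _ => selective_univ le_rfl) (j := 30) (by
      refine mul_lt_pow_of_lt hn ?_
      have h1 : (n : ℝ) ≤ (n : ℝ) ^ 4 := le_self_pow₀ (by linarith) (by norm_num)
      push_cast
      linarith)
  refine ⟨A, fun G s hs => ?_⟩
  obtain ⟨h1, h2, h3⟩ := hA G s hs
  refine ⟨h1.mono hg, h2.mono ?_, h3.mono ?_⟩
  · have h4 : (n : ℝ) ^ (1 + a) = n * (n : ℝ) ^ a := by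
      rw [Real.rpow_add (by linarith), Real.rpow_one]
    have h5 : 1 ≤ (n : ℝ) ^ a := Real.one_le_rpow (by linarith) ha
    have h6 : (n : ℝ) ≤ (n : ℝ) ^ (1 + a) := by rw [h4]; nlinarith
    have h7 : (n : ℝ) * threshold n (fun _ => a) 0 ≤ 84 * (n : ℝ) ^ (1 + a) := by
      rw [h4]; nlinarith
    push_cast
    linarith
  · push_cast
    linarith

/-- Detection from the members of selective families, with growing thresholds. -/
theorem exists_algorithm_selective {n k : ℕ} {ε ρ : ℝ} (hk : 1 ≤ k) (hε : 0 < ε) (hρ : 0 < ρ)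
    (hρ1 : ρ < 1) (hβ : beta ε ρ k < n) (hkρ : 2 < k * ρ) :
    ∃ A : Algorithm n,
      ∀ (G : SimpleGraph (Fin n)) (s : List (Sym2 (Fin n))), IsEdgeStream G s →
        A.ComputesAPSP G s (4 + ε) (21 * beta ε ρ k) ∧
        A.SurelyLE s Config.peak (22000 * (n : ℝ) ^ (1 + 1 / (k : ℝ)) + 63 * (beta ε ρ k * n)) ∧
        A.SurelyLE s Config.passes
          (100000000 * ((n : ℝ) ^ ρ / ρ * Real.log n * beta ε ρ k)) := by
  have hn := two_le_of_beta_lt hε hρ hk hβ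
  have hn' : (2 : ℝ) ≤ n := by exact_mod_cast hn
  have hk0 : (0 : ℝ) < k := by exact_mod_cast hk
  have hβ1 := one_le_beta hε hρ hk
  have hℓ := levels_le hρ hk hkρ
  have hg := growthRate_pow_le hε hρ hk hℓ
  have hlog := one_div_le_log hε hρ hk hβ
  have hlogn : Real.log n ≤ n := (Real.log_le_sub_one_of_pos (by linarith)).trans (by linarith)
  have hρ' : 1 ≤ 1 / ρ := by rw [le_div_iff₀ hρ]; linarith
  have hnρ : 1 ≤ (n : ℝ) ^ ρ := Real.one_le_rpow (by linarith) hρ.le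
  have hnρ' : (n : ℝ) ^ ρ ≤ n := by
    simpa using Real.rpow_le_rpow_of_exponent_le (show 1 ≤ (n : ℝ) by linarith) hρ1.le
  obtain ⟨F, hF1, hF2⟩ := exists_selective_doublingExponent (n := n) (k := k) (by omega) hρ hρ1
  have hpasses : ((F.length : ℝ) + 1) *
      (4 * growthRate ε ^ (growthLevels ρ k + ⌈2 / ρ⌉₊)) ≤
      33554432 * ((n : ℝ) ^ ρ / ρ * (1 / ρ) * beta ε ρ k) := by
    have h5 := five_le_growthRate hε
    have h1 : (n : ℝ) ^ ρ / ρ ^ 2 = (n : ℝ) ^ ρ / ρ * (1 / ρ) := by field_simp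
    rw [h1] at hF1
    have h2 : 1 ≤ (n : ℝ) ^ ρ / ρ * (1 / ρ) := by
      have : 1 ≤ (n : ℝ) ^ ρ / ρ := by rw [le_div_iff₀ hρ]; linarith
      nlinarith
    calc ((F.length : ℝ) + 1) * (4 * growthRate ε ^ (growthLevels ρ k + ⌈2 / ρ⌉₊))
        ≤ (254017 * ((n : ℝ) ^ ρ / ρ * (1 / ρ))) * (4 * (21 * beta ε ρ k)) := by
          gcongr
          linarith
      _ = 21337428 * ((n : ℝ) ^ ρ / ρ * (1 / ρ) * beta ε ρ k) := by ring
      _ ≤ _ := by gcongr; norm_num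
  obtain ⟨A, hA⟩ := exists_algorithm_of_exponents hn hε (e := doublingExponent ρ k)
    (doublingExponent_nonneg hρ) (doublingExponent_succ_le hρ) (one_le_sum_doublingExponent hρ hk)
    le_rfl (one_le_threshold (by omega)) (F := fun _ => F) (N := F.length) (fun _ _ => le_rfl)
    (fun i _ => hF2 i) (j := 30) (by
      refine mul_lt_pow_of_lt hn (hpasses.trans ?_)
      -- Each factor is at most `n`, because `1 / ρ ≤ log n ≤ n` and `beta < n`.
      have h1 : (n : ℝ) ^ ρ / ρ * (1 / ρ) * beta ε ρ k ≤ n * n * n * n := by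
        rw [div_eq_mul_one_div]
        gcongr <;> linarith
      nlinarith)
  refine ⟨A, fun G s hs => ?_⟩
  obtain ⟨h1, h2, h3⟩ := hA G s hs
  refine ⟨h1.mono hg, h2.mono ?_, h3.mono (hpasses.trans ?_)⟩
  · have h4 : (n : ℝ) ^ (1 + doublingExponent ρ k 0) ≤ (n : ℝ) ^ (1 + 1 / (k : ℝ)) := by
      refine Real.rpow_le_rpow_of_exponent_le (by linarith) ?_
      have : doublingExponent ρ k 0 ≤ 1 / k := by simp [doublingExponent]
      linarith
    have h5 : (n : ℝ) ≤ (n : ℝ) ^ (1 + 1 / (k : ℝ)) := by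
      have : 0 ≤ 1 / (k : ℝ) := by positivity
      simpa using Real.rpow_le_rpow_of_exponent_le (show 1 ≤ (n : ℝ) by linarith)
        (show 1 ≤ 1 + 1 / (k : ℝ) by linarith)
    have h6 : ((growthLevels ρ k + ⌈2 / ρ⌉₊ : ℕ) : ℝ) ≤ 21 * beta ε ρ k := by
      refine le_trans ?_ hg
      have h7 := five_le_growthRate hε
      have h8 : (2 : ℝ) ^ (growthLevels ρ k + ⌈2 / ρ⌉₊) ≤
          growthRate ε ^ (growthLevels ρ k + ⌈2 / ρ⌉₊) := by gcongr; linarith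
      exact le_trans (by exact_mod_cast Nat.lt_two_pow_self.le) h8
    have h7 : ((growthLevels ρ k + ⌈2 / ρ⌉₊ : ℕ) : ℝ) * n ≤ 21 * beta ε ρ k * n := by gcongr
    push_cast at h7 ⊢
    linarith
  · gcongr
    norm_num

end

end Streaming

end

theorem lemma7 :
    ∃ C₀ : ℝ, 0 < C₀ ∧ ∀ c : ℝ, 0 < c → ∃ C : ℝ, 0 < C ∧
      ∀ (n k : ℕ) (ε ρ : ℝ), 1 ≤ n → 1 ≤ k → 0 < ε → 0 < ρ → ρ < 1 →
        (∃ A : Streaming.Algorithm n,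
          ∀ (G : SimpleGraph (Fin n)) (s : List (Sym2 (Fin n))), Streaming.IsEdgeStream G s →
            A.ComputesAPSP G s (4 + ε) (C₀ * Streaming.beta ε ρ k) ∧
            A.ProbLE s Streaming.Config.peak
              (C * ((n : ℝ) ^ (1 + ρ) * Real.log n)) (1 - (n : ℝ) ^ (-c)) ∧
            A.SurelyLE s Streaming.Config.passes (C₀ * Streaming.beta ε ρ k)) ∧
        (∃ A : Streaming.Algorithm n,
          ∀ (G : SimpleGraph (Fin n)) (s : List (Sym2 (Fin n))), Streaming.IsEdgeStream G s →
            A.ComputesAPSP G s (4 + ε) (C₀ * Streaming.beta ε ρ k) ∧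
            A.ExpectedLE s Streaming.Config.peak
              (C₀ * ((n : ℝ) ^ (1 + 1 / (k : ℝ)) +
                (Streaming.beta ε ρ k + Real.log n) * (n : ℝ))) ∧
            A.ProbLE s Streaming.Config.passes
              (C * ((n : ℝ) ^ ρ / ρ * Real.log n * Streaming.beta ε ρ k))
              (1 - (n : ℝ) ^ (-c))) := by
  refine ⟨30000, by norm_num, fun c _ => ⟨100000000, by norm_num, fun n k ε ρ hn hk hε hρ hρ1 => ?_⟩⟩
  have hβ1 := Streaming.one_le_beta hε hρ hk
  rcases le_or_gt (n : ℝ) (Streaming.beta ε ρ k) with hβ | hβ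
  · obtain ⟨A, hA⟩ := Streaming.exists_algorithm_of_le_beta hn hk hε hρ hρ1 c hβ
    refine ⟨⟨A, fun G s hs => ?_⟩, ⟨A, fun G s hs => ?_⟩⟩
    · obtain ⟨h1, h2, h3, -, -⟩ := hA G s hs
      exact ⟨h1, h2, h3⟩
    · obtain ⟨h1, -, -, h4, h5⟩ := hA G s hs
      exact ⟨h1, h4, h5⟩
  have hn' : (1 : ℝ) ≤ n := by exact_mod_cast hn
  have hlog := Streaming.one_div_le_log hε hρ hk hβ
  have hρ' : 1 ≤ 1 / ρ := by rw [le_div_iff₀ hρ]; linarith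
  constructor
  · obtain ⟨A, hA⟩ := Streaming.exists_algorithm_uniform (ℓ := ⌈1 / ρ⌉₊) (a := ρ) hk hε hρ hβ hρ.le
      (by rw [← div_le_iff₀ hρ]; exact Nat.le_ceil _) (Streaming.ceil_one_div_le hρ hk)
    refine ⟨A, fun G s hs => ?_⟩
    obtain ⟨h1, h2, h3⟩ := hA G s hs
    refine ⟨h1.mono (by linarith), (h2.mono ?_).probLE (Streaming.one_sub_rpow_neg_le_one n c),
      h3.mono (by linarith)⟩
    -- The `⌈1 / ρ⌉₊` forests of `n` edges fit because `1 ≤ 1 / ρ ≤ log n`.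
    have h4 : ((⌈1 / ρ⌉₊ : ℕ) : ℝ) ≤ 2 * Real.log n := by
      have := (Nat.ceil_lt_add_one (show 0 ≤ 1 / ρ by positivity)).le
      linarith
    have h5 : (n : ℝ) ≤ (n : ℝ) ^ (1 + ρ) := by
      simpa using Real.rpow_le_rpow_of_exponent_le hn' (show 1 ≤ 1 + ρ by linarith)
    have h6 : ((⌈1 / ρ⌉₊ : ℕ) : ℝ) * n ≤ 2 * Real.log n * (n : ℝ) ^ (1 + ρ) := by
      gcongr
    nlinarith
  -- For `k * ρ ≤ 2` the exponent of `beta` already allows `k` levels with exponent `1 / k`;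
  -- otherwise the exponents must grow to shorten the hierarchy.
  · rcases le_or_gt (k * ρ) 2 with hkρ | hkρ
    · have hk0 : (0 : ℝ) < k := by exact_mod_cast hk
      have hkE := Streaming.natCast_le_betaExponent_add_one hρ hk hkρ
      obtain ⟨A, hA⟩ := Streaming.exists_algorithm_uniform (ℓ := k) (a := 1 / k) hk hε hρ hβ
        (by positivity) (by rw [mul_one_div_cancel hk0.ne']) hkE
      refine ⟨A, fun G s hs => ?_⟩
      obtain ⟨h1, h2, h3⟩ := hA G s hs
      refine ⟨h1.mono (by linarith), (h2.mono ?_).expectedLE,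
        (h3.mono ?_).probLE (Streaming.one_sub_rpow_neg_le_one n c)⟩
      -- The term `k * n` of the forests is absorbed by `beta * n`, since `k ≤ 2 ^ k ≤ growthRate ε
      -- ^ k`.
      · have h4 : (k : ℝ) ≤ 21 * Streaming.beta ε ρ k := by
          refine le_trans ?_ (Streaming.growthRate_pow_le hε hρ hk hkE)
          have h5 := Streaming.five_le_growthRate hε
          have h6 : (2 : ℝ) ^ k ≤ Streaming.growthRate ε ^ k := by gcongr; linarith
          exact le_trans (by exact_mod_cast Nat.lt_two_pow_self.le) h6
        have h7 : 0 ≤ Real.log n := Real.log_nonneg hn'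
        have h8 : (k : ℝ) * n ≤ 21 * Streaming.beta ε ρ k * n := by gcongr
        have h9 : 0 ≤ (n : ℝ) ^ (1 + 1 / (k : ℝ)) := by positivity
        nlinarith
      · have h4 : 1 ≤ (n : ℝ) ^ ρ / ρ := by
          rw [le_div_iff₀ hρ]
          have := Real.one_le_rpow hn' hρ.le
          linarith
        have h5 : 1 ≤ (n : ℝ) ^ ρ / ρ * Real.log n := by nlinarith
        nlinarith
    · obtain ⟨A, hA⟩ := Streaming.exists_algorithm_selective hk hε hρ hρ1 hβ hkρ
      refine ⟨A, fun G s hs => ?_⟩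
      obtain ⟨h1, h2, h3⟩ := hA G s hs
      refine ⟨h1.mono (by linarith), (h2.mono ?_).expectedLE,
        h3.probLE (Streaming.one_sub_rpow_neg_le_one n c)⟩
      have h4 : 0 ≤ Real.log n := Real.log_nonneg hn'
      have h5 : 0 ≤ (n : ℝ) ^ (1 + 1 / (k : ℝ)) := by positivity
      nlinarith
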